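/- \textbf{Setting.} All Fréchet spaces are real. Let $F$ be a Fréchet space. A map $f:U\to G$ from an open subset $U$ of a Fréchet space $E$ to a Fréchet space $G$ is of class \emph{Keller $C_c^1$} if for all $x\in U$ the directional derivatives $Df(x)h=\lim_{t\to0}(f(x+th)-f(x))/t$ exist and define a continuous linear map $Df(x)\in \mathsf L(E,G)$, and $x\mapsto Df(x)$ is continuous from $U$ to $\mathsf L(E,G)$ with the topology of uniform convergence on compact sets. Let $M$ be a connected regular Hausdorff $C_c^1$-manifold modelled on $F$ (all chart transitions are Keller $C_c^1$). Let $(\|\cdot\|_n)_{n\in\mathbb N}$ be a graded Finsler structure on $TM$: functions $\|\cdot\|_n:TM\to[0,\infty)$ with $\|\cdot\|_n\le\|\cdot\|_{n+1}$ such that every point of $M$ lies in the domain $U$ of a chart in whose induced trivialization $TM|_U\cong U\times F$ (i) each $\|\cdot\|_n$ is continuous, (ii) for each fixed $b\in U$ the functions $\|\cdot\|_n^b$ are seminorms on $F$ defining the topology of $F$, and (iii) for all $k>1$ and $x_0\in U$ there is a neighbourhood $W$ of $x_0$ with $\frac1k\|v\|_n^{x_0}\le\|v\|_n^{w}\le k\|v\|_n^{x_0}$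 for all $w\in W\cap U$, $n\in\mathbb N$, $v\in F$. Let $\rho_n(x,y)$ be the infimum of the lengths $\int\|\gamma'(t)\|_n\,dt$ of piecewise $C^1$ curves $\gamma$ from $x$ to $y$, number the components from $n=1$, let $\rho=\sum_{n\ge1}2^{-n}\rho_n/(1+\rho_n)$, and assume that $\rho$ is complete. Let $L$ be a compact Lie group acting continuously on $M$ such that each transformation $x\mapsto l\cdot x$ is of class Keller $C_c^1$. An \emph{$L$-index} on $M$ is a map $\mathrm{Ind}$ from the closed $L$-invariant subsets of $M$ to $\mathbb N\cup\{\infty\}$ (with $0\in\mathbb N$) such that for all such $A,B$: $\mathrm{Ind}(A)=0$ iff $A=\emptyset$; $\mathrm{Ind}(A\cup B)\le\mathrm{Ind}(A)+\mathrm{Ind}(B)$; $\mathrm{Ind}(A)\le\mathrm{Ind}(B)$ whenever there is a continuous $L$-equivariant map $A\to B$; and if $A$ is compact, there is an $L$-invariant open $\mathcal U\supseteq A$ with $\mathrm{Ind}(\overline{\mathcal U})=\mathrm{Ind}(A)$. Fix an $L$-index on $M$. Let $\varphi:M\to\mathbb R$ be a non-constant $L$-invariant functional of class Keller $C_c^1$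 which is closed, that is, maps closed sets to closed sets. For $x\in M$ put $\Phi_\varphi(x)=\inf\{\varphi'(x,h): h\in T_xM,\ \|h\|_n\le1\text{ for all }n\}$. For $c\in\mathbb R$, $\varphi$ satisfies $(PS)_c$ if every sequence $(x_i)$ in $M$ with $\varphi(x_i)\to c$ and $\Phi_\varphi(x_i)\to0$ has a convergent subsequence. Let $\mathrm{Cr}(\varphi,c)$ be the set of $x\in M$ with $\varphi(x)=c$ and $\varphi'(x,\cdot)=0$. For $i\in\mathbb N$ put $$c_i=\inf\Big\{\max_{x\in A}\varphi(x)\ :\ A\subseteq M \text{ compact and } L\text{-invariant},\ \mathrm{Ind}(A)\ge i\Big\}\in[-\infty,+\infty]$$ (with $\max_\emptyset\varphi=-\infty$ and $\inf\emptyset=+\infty$). \textbf{Theorem.} Let $n\le m$ be natural numbers and $c\in\mathbb R$ such that $c=c_n=c_m$, and suppose that $\varphi$ satisfies $(PS)_c$. Then $\mathrm{Cr}(\varphi,c)$ is closed and $L$-invariant, $\mathrm{Ind}(\mathrm{Cr}(\varphi,c))\ge m-n+1$, and in particular $\mathrm{Cr}(\varphi,c)\neq\emptyset$. -/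

import Mathlib

open Set Filter Topology
open scoped Manifold ContDiff

noncomputable section

namespace FrechetLS

/-! ### Keller `C_c^1` maps between Fréchet spaces -/

section Keller

variable {E G : Type*}
  [AddCommGroup E] [Module ℝ E] [TopologicalSpace E]
  [AddCommGroup G] [Module ℝ G] [TopologicalSpace G]

/-- The directional derivative `lim_{t → 0} (f (x + t h) - f x) / t`
(only meaningful when the limit exists). -/
def dirDeriv (f : E → G) (x h : E) : G :=
  limUnder (𝓝[≠] (0 : ℝ)) (fun t : ℝ => t⁻¹ • (f (x + t • h) - f x))

/-- `f` is of class Keller `C_c^1` on the (open) set `U`: the directional derivatives at the points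
of `U` exist and form continuous linear maps `f' x`, and `x ↦ f' x` is continuous on `U` for the
topology of uniform convergence on compact sets. -/
def KellerC1On [IsTopologicalAddGroup G] [ContinuousConstSMul ℝ G]
    (f : E → G) (U : Set E) : Prop :=
  ∃ f' : E → CompactConvergenceCLM (RingHom.id ℝ) E G,
    (∀ x ∈ U, ∀ h : E,
      Tendsto (fun t : ℝ => t⁻¹ • (f (x + t • h) - f x)) (𝓝[≠] 0) (𝓝 (f' x h))) ∧
    ContinuousOn f' U

end Keller

/-! ### Keller `C_c^1` manifolds and maps between them -/

section Manifold

variable (F : Type*) [AddCommGroup F] [Module ℝ F] [UniformSpace F]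
  (M : Type*) [TopologicalSpace M] [ChartedSpace F M]

/-- All coordinate transition functions of the atlas are Keller `C_c^1`. -/
def IsKellerManifold [IsTopologicalAddGroup F] [ContinuousConstSMul ℝ F] : Prop :=
  ∀ e ∈ atlas F M, ∀ e' ∈ atlas F M,
    KellerC1On (fun z => e' (e.symm z)) (e.symm.trans e').source

variable {F M}

/-- `e` is a chart of the `C_c^1` structure (it belongs to the maximal atlas). -/
def IsKellerChart [IsTopologicalAddGroup F] [ContinuousConstSMul ℝ F]
    (e : OpenPartialHomeomorph M F) : Prop :=
  ∀ e' ∈ atlas F M,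
    KellerC1On (fun z => e' (e.symm z)) (e.symm.trans e').source ∧
    KellerC1On (fun z => e (e'.symm z)) (e'.symm.trans e).source

variable (F)

/-- A continuous map of `M` into itself which is Keller `C_c^1` in all charts. -/
def IsKellerC1SelfMap [IsTopologicalAddGroup F] [ContinuousConstSMul ℝ F] (f : M → M) : Prop :=
  Continuous f ∧ ∀ e ∈ atlas F M, ∀ e' ∈ atlas F M,
    KellerC1On (fun z => e' (f (e.symm z))) (e.target ∩ e.symm ⁻¹' (f ⁻¹' e'.source))

/-- A functional on `M` which is Keller `C_c^1` in all charts. -/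
def IsKellerC1Functional (φ : M → ℝ) : Prop :=
  Continuous φ ∧ ∀ e ∈ atlas F M, KellerC1On (fun z => φ (e.symm z)) e.target

/-! The tangent space `T_x M` is the model space `F`, a vector being given by its coordinates in the
preferred chart `chartAt F x`. -/

variable {F}

/-- The coordinate change on `T_x M` from the chart `e` to the chart `e'`. -/
def kellerCoordChange (e e' : OpenPartialHomeomorph M F) (x : M) (v : F) : F :=
  dirDeriv (fun z => e' (e.symm z)) (e x) v

variable (F)

/-- The differential `φ'(x, h)` of a functional at `x`, applied to `h ∈ T_x M`. -/
def differential (φ : M → ℝ) (x : M) (h : F) : ℝ :=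
  dirDeriv (fun z => φ ((chartAt F x).symm z)) (chartAt F x x) h

/-- The critical points of `φ` at level `c`. -/
def criticalSet (φ : M → ℝ) (c : ℝ) : Set M :=
  {x | (∀ h : F, differential F φ x h = 0) ∧ φ x = c}

variable {F}

/-! ### Finsler structures -/

/-- A Finsler structure on the trivial bundle `U × F`. -/
structure IsTrivialFinsler (U : Set M) (q : ℕ → M → F → ℝ) : Prop where
  continuousOn : ∀ n, ContinuousOn (fun z : M × F => q n z.1 z.2) (U ×ˢ univ)
  seminorms : ∀ b ∈ U, ∃ p : SeminormFamily ℝ F ℕ, (∀ n v, p n v = q n b v) ∧ WithSeminorms p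
  comparison : ∀ k : ℝ, 1 < k → ∀ x₀ ∈ U, ∃ W ∈ 𝓝 x₀, ∀ w ∈ W ∩ U, ∀ (n : ℕ) (v : F),
    1 / k * q n x₀ v ≤ q n w v ∧ q n w v ≤ k * q n x₀ v

variable (F M)

/-- A Finsler structure on the tangent bundle of `M`: functions `‖·‖_n` on `T M` which form, near
each point and in the bundle chart induced by some chart of `M`, a Finsler structure of the
trivial bundle. -/
structure FinslerStructure [IsTopologicalAddGroup F] [ContinuousConstSMul ℝ F] where
  nrm : ℕ → (x : M) → F → ℝ
  locally_trivial : ∀ x : M, ∃ e : OpenPartialHomeomorph M F, IsKellerChart e ∧ x ∈ e.source ∧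
    IsTrivialFinsler e.source
      (fun n y v => nrm n y (kellerCoordChange e (chartAt F y) y v))

variable {F M}

/-- `γ : [a, b] → M` is a `C^1` curve, with velocity `v t ∈ T_{γ t} M` at time `t`. -/
structure IsC1Curve (γ : ℝ → M) (v : ℝ → F) (a b : ℝ) : Prop where
  continuousOn : ContinuousOn γ (Icc a b)
  velocity : ∀ t ∈ Icc a b,
    Tendsto (slope (fun s => chartAt F (γ t) (γ s)) t) (𝓝[Icc a b \ {t}] t) (𝓝 (v t))
  continuousOn_velocity : ∀ e ∈ atlas F M,
    ContinuousOn (fun t => kellerCoordChange (chartAt F (γ t)) e (γ t) (v t))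
      (Icc a b ∩ γ ⁻¹' e.source)

namespace FinslerStructure

variable [IsTopologicalAddGroup F] [ContinuousConstSMul ℝ F] (N : FinslerStructure F M)

/-- The structure is graded: `‖·‖_n ≤ ‖·‖_{n+1}` for all `n`. -/
def IsGraded : Prop := ∀ n x v, N.nrm n x v ≤ N.nrm (n + 1) x v

/-- The lengths, for the `n`-th component, of the piecewise `C^1` curves connecting `x` to `y`;
the pieces are the restrictions to the intervals `[τ i, τ (i+1)]`, `i < k`. -/
def lengths (n : ℕ) (x y : M) : Set ℝ :=
  {ℓ | ∃ (γ : ℝ → M) (k : ℕ) (τ : ℕ → ℝ) (v : ℕ → ℝ → F),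
    (∀ i < k, τ i < τ (i + 1) ∧ IsC1Curve γ (v i) (τ i) (τ (i + 1))) ∧
    γ (τ 0) = x ∧ γ (τ k) = y ∧
    ℓ = ∑ i ∈ Finset.range k, ∫ t in (τ i)..(τ (i + 1)), N.nrm n (γ t) (v i t)}

/-- The distance `ρ_n`. -/
def distComponent (n : ℕ) (x y : M) : ℝ := sInf (N.lengths n x y)

/-- The Finsler metric `ρ` (components are numbered from `0`, hence the exponent `n + 1`). -/
def finslerDist (x y : M) : ℝ :=
  ∑' n : ℕ, (1 / 2 ^ (n + 1)) * (N.distComponent n x y / (1 + N.distComponent n x y))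

/-- Every Cauchy sequence for `ρ` converges for `ρ`. -/
def IsComplete : Prop :=
  ∀ u : ℕ → M,
    (∀ ε > 0, ∃ K, ∀ i ≥ K, ∀ j ≥ K, N.finslerDist (u i) (u j) < ε) →
    ∃ x, Tendsto (fun i => N.finslerDist (u i) x) atTop (𝓝 0)

/-- `B_∞(0_x)`, the intersection of the closed unit semi-balls of `T_x M`. -/
def unitBall (x : M) : Set F := {h | ∀ n, N.nrm n x h ≤ 1}

/-- `Φ_φ(x) = inf {φ'(x, h) : h ∈ B_∞(0_x)}`. -/
def slopeFunction (φ : M → ℝ) (x : M) : ℝ := sInf (differential F φ x '' N.unitBall x)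

/-- The Palais–Smale condition at level `c`. -/
def PalaisSmale (φ : M → ℝ) (c : ℝ) : Prop :=
  ∀ u : ℕ → M, Tendsto (fun i => φ (u i)) atTop (𝓝 c) →
    Tendsto (fun i => N.slopeFunction φ (u i)) atTop (𝓝 0) →
    ∃ (x : M) (s : ℕ → ℕ), StrictMono s ∧ Tendsto (u ∘ s) atTop (𝓝 x)

end FinslerStructure

end Manifold

/-! ### Group actions, indices, minimax values -/

section Index

variable (L : Type*) [Group L] {M : Type*} [TopologicalSpace M] [MulAction L M]

/-- `A` is `L`-invariant. -/
def IsInvariantSet (A : Set M) : Prop := ∀ l : L, ∀ x ∈ A, l • x ∈ A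

variable (M)

/-- An `L`-index on `M`. It is a function on the closed `L`-invariant subsets of `M`; its values on
other subsets are irrelevant. -/
structure LIndex where
  ind : Set M → ℕ∞
  eq_zero_iff : ∀ A, IsClosed A → IsInvariantSet L A → (ind A = 0 ↔ A = ∅)
  union_le : ∀ A B, IsClosed A → IsInvariantSet L A → IsClosed B → IsInvariantSet L B →
    ind (A ∪ B) ≤ ind A + ind B
  mono : ∀ A B, IsClosed A → IsInvariantSet L A → IsClosed B → IsInvariantSet L B →
    ∀ f : M → M, ContinuousOn f A → MapsTo f A B → (∀ l : L, ∀ x ∈ A, f (l • x) = l • f x) →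
    ind A ≤ ind B
  exists_nhds : ∀ A, IsCompact A → IsClosed A → IsInvariantSet L A →
    ∃ U, IsOpen U ∧ IsInvariantSet L U ∧ A ⊆ U ∧ ind (closure U) = ind A

variable {L M}

/-- The minimax value `c_i`, the infimum of `max_A φ` over the compact `L`-invariant sets `A` of
index at least `i`, as an extended real number. -/
def LIndex.minimax (J : LIndex L M) (φ : M → ℝ) (i : ℕ) : EReal :=
  ⨅ A ∈ {A : Set M | IsCompact A ∧ IsInvariantSet L A ∧ (i : ℕ∞) ≤ J.ind A},
    ⨆ x ∈ A, ((φ x : ℝ) : EReal)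

end Index

end FrechetLS

end

/-!
Why `mainTheorem2` holds. Write `Z` for the level set `φ = c` and `K ⊆ Z` for the critical set.

*Closedness forces finite dimension.* If the derivative of a closed functional is non-zero at a
point `u` of a chart, in a direction `h`, then the level set through `u` is compact near `u`: a
sequence in it can be pushed slightly along `h` to strictly larger levels which tend to the given
one, and a closed functional cannot take such values along a sequence without accumulation points
(`exists_mapClusterPt_of_isClosedMap`). The translates of this compact piece along `h` sweep out a
neighbourhood of `u`, so the model space is finite-dimensional
(`finiteDimensional_of_deriv_ne_zero`); and a functional without such points is constant. From then
on the model space carries a norm, and Keller `C_c^1` means `C^1` (`KellerC1On.contDiffOn`).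

*The level set is compact* (`FinslerStructure.isCompact_level`). Sequences of critical points
accumulate by the Palais–Smale condition; regular points of `Z` are limits of points outside `Z`, so
that sequences of them accumulate because `φ` is closed. Passing from sequences to open covers
requires some uniformity on `M`, and this is what the Finsler structure supplies: the points
reached from `x` by short chart segments form neighbourhoods of `x` that shrink locally uniformly
(`FinslerStructure.exists_segmentNhd_subset`), which is enough for a Lebesgue number argument
(`isCompact_of_development`).

*Equivariant descent* (`exists_equivariant_decrease`). Near a regular point `x₀` one needs a
continuous `L`-equivariant map `η` which decreases `φ` wherever it moves a point, and moves `x₀`. By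
Baire's theorem the derivatives of the transformations `l ∈ L` are jointly continuous on `L × M`
(`IsC1ActionIn.continuousAt_actDeriv`, after Bochner and Montgomery). The naive step
`x ↦ x + t h` in a chart `e` is then made equivariant by averaging the equation it solves: `η x` is
the point `y` near `x` with
`∫ χ (g x) T g⁻¹ (e (g y) - e (g x) - t(x) h) dg = 0` in `T_x M`, where `χ` is a bump function and
`t` an invariant step size. Up to a factor, the left side is close to the identity as a function of
`y`, so it has a unique zero; averaging the differentials preserves the direction of descent since
`φ` is invariant.

*Minimax* (`LIndex.le_ind_of_minimax_eq`). Suppose `Ind K ≤ m - n`, and take an invariant open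
`U ⊇ K` with `Ind (closure U) = Ind K`. Finitely many local maps compose to an equivariant `η` that
decreases `φ` on the compact set `Z \ U`; as `φ` is closed, `η` then lowers all points outside `U` at
levels in some `(c - ε, c + ε)` to levels at most `c - ε`. A compact invariant set `A` with
`Ind A ≥ m` and `φ < c + ε` gives `Ind (A \ U) ≥ n`, and `η (A \ U)` contradicts `c_n = c`.
-/

namespace FrechetLS

/-! ### Closed functionals and finite-dimensionality of the model space -/

/-- If the values of a closed functional along a sequence tend to `c` without attaining it, then the
sequence accumulates: otherwise its range would be a closed set with a non-closed image. -/
theorem exists_mapClusterPt_of_isClosedMap {X : Type*} [TopologicalSpace X] [T1Space X]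
    {φ : X → ℝ} (hφ : IsClosedMap φ) {c : ℝ} {y : ℕ → X}
    (hlim : Tendsto (fun i => φ (y i)) atTop (𝓝 c)) (hne : ∀ i, φ (y i) ≠ c) :
    ∃ z, φ z = c ∧ MapClusterPt z atTop y := by
  have h1 : c ∈ closure (φ '' range y) :=
    mem_closure_of_tendsto hlim (Eventually.of_forall fun i => ⟨y i, ⟨i, rfl⟩, rfl⟩)
  obtain ⟨z, hz, hzc⟩ := hφ.closure_image_subset _ h1
  refine ⟨z, hzc, ?_⟩
  rw [mapClusterPt_iff_frequently]
  intro s hs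
  by_contra hcon
  rw [not_frequently, eventually_atTop] at hcon
  obtain ⟨N, hN⟩ := hcon
  have hfin : (y '' Iio N).Finite := (finite_Iio N).image y
  have hzn : z ∉ y '' Iio N := by
    rintro ⟨i, -, rfl⟩
    exact hne i hzc
  have hs' : s ∩ (y '' Iio N)ᶜ ∈ 𝓝 z :=
    inter_mem hs (hfin.isClosed.isOpen_compl.mem_nhds hzn)
  obtain ⟨w, ⟨hws, hwn⟩, i, rfl⟩ := mem_closure_iff_nhds.1 hz _ hs'
  rcases lt_or_ge i N with hi | hi
  · exact hwn ⟨i, hi, rfl⟩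
  · exact hN i hi hws

section Gateaux

variable {F : Type*} [AddCommGroup F] [Module ℝ F]

theorem hasDerivAt_line [TopologicalSpace F] {G : Type*} [NormedAddCommGroup G] [NormedSpace ℝ G] {f : F → G}
    {f' : F → CompactConvergenceCLM (RingHom.id ℝ) F G} {x h : F} {s : ℝ}
    (hf : Tendsto (fun t : ℝ => t⁻¹ • (f (x + s • h + t • h) - f (x + s • h))) (𝓝[≠] 0)
      (𝓝 (f' (x + s • h) h))) :
    HasDerivAt (fun t : ℝ => f (x + t • h)) (f' (x + s • h) h) s := by
  rw [hasDerivAt_iff_tendsto_slope_zero]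
  refine hf.congr fun t => ?_
  rw [add_smul, add_assoc]

theorem dirDeriv_eq {G : Type*} [AddCommGroup G] [Module ℝ G] [TopologicalSpace G] [T2Space G]
    {f : F → G} {x h : F} {d : G}
    (hf : Tendsto (fun t : ℝ => t⁻¹ • (f (x + t • h) - f x)) (𝓝[≠] 0) (𝓝 d)) :
    dirDeriv f x h = d := hf.limUnder_eq

end Gateaux

section FiniteDim

variable {F : Type*} [AddCommGroup F] [Module ℝ F] [UniformSpace F] [IsUniformAddGroup F]
    [ContinuousSMul ℝ F] [T2Space F] [FirstCountableTopology F]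
    {M : Type*} [TopologicalSpace M] [T3Space M]

/-- A closed functional can only have a non-zero derivative somewhere if the model space is
finite-dimensional: near such a point the level set is transverse to a direction `h`, it is locally
compact since the functional is closed, and translating it along `h` sweeps out a neighbourhood. -/
theorem finiteDimensional_of_deriv_ne_zero {φ : M → ℝ} (hφ : Continuous φ) (hcl : IsClosedMap φ)
    (e : OpenPartialHomeomorph M F) {f : F → ℝ} (hfφ : ∀ u, f u = φ (e.symm u))
    {f' : F → CompactConvergenceCLM (RingHom.id ℝ) F ℝ}
    (hf : ∀ x ∈ e.target, ∀ h : F,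
      Tendsto (fun t : ℝ => t⁻¹ • (f (x + t • h) - f x)) (𝓝[≠] 0) (𝓝 (f' x h)))
    (hf' : ContinuousOn f' e.target) {u₀ h : F} (hu₀ : u₀ ∈ e.target) (hne : f' u₀ h ≠ 0) :
    FiniteDimensional ℝ F := by
  wlog hpos : 0 < f' u₀ h generalizing h
  · refine this (h := -h) (by simpa using hne) ?_
    rw [map_neg]
    have := lt_of_le_of_ne (not_lt.1 hpos) hne
    linarith
  have hcg : (uniformity F).IsCountablyGenerated := IsUniformAddGroup.uniformity_countably_generated
  have hev : ContinuousOn (fun u => f' u h) e.target := hf'.eval_const h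
  have hN : ∀ᶠ u in 𝓝 u₀, u ∈ e.target ∧ 0 < f' u h :=
    (e.open_target.eventually_mem hu₀).and
      ((hev.continuousAt (e.open_target.mem_nhds hu₀)).eventually (lt_mem_nhds hpos))
  have hN' : ∀ᶠ x in 𝓝 (e.symm u₀), x ∈ e.source ∧ 0 < f' (e x) h := by
    have hs := e.map_target hu₀
    have h1 : Tendsto e (𝓝 (e.symm u₀)) (𝓝 u₀) := by
      simpa [ContinuousAt, e.right_inv hu₀] using e.continuousAt hs
    filter_upwards [e.open_source.mem_nhds hs, h1.eventually hN] with x hx hx'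
    exact ⟨hx, hx'.2⟩
  obtain ⟨D, hD, hDcl, hDsub⟩ := exists_mem_nhds_isClosed_subset hN'
  have hDF : ∀ᶠ u in 𝓝 u₀, u ∈ e.target ∧ e.symm u ∈ D :=
    (e.open_target.eventually_mem hu₀).and ((e.continuousAt_symm hu₀).eventually hD)
  have hadd : Tendsto (fun p : F × ℝ => p.1 + p.2 • h) (𝓝 (u₀, 0)) (𝓝 u₀) := by
    have : Continuous (fun p : F × ℝ => p.1 + p.2 • h) := by fun_prop
    simpa using this.tendsto (u₀, 0)
  -- `C₀` is a closed neighbourhood of `u₀`, and the segments in the direction `h` starting in it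
  -- stay in the region where `φ` increases along `h`
  have key : ∀ S ∈ 𝓝 u₀, ∃ δ > 0, ∃ C ∈ 𝓝 u₀, IsClosed C ∧
      ∀ u ∈ C, ∀ t : ℝ, |t| ≤ δ → u + t • h ∈ S := by
    intro S hS
    obtain ⟨A, hA, B, hB, hAB⟩ := mem_nhds_prod_iff.1 (hadd hS)
    obtain ⟨C, hC, hCcl, hCA⟩ := exists_mem_nhds_isClosed_subset hA
    obtain ⟨δ, hδ, hδB⟩ := Metric.mem_nhds_iff.1 hB
    refine ⟨δ / 2, by positivity, C, hC, hCcl, fun u hu t ht => ?_⟩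
    refine hAB (mk_mem_prod (hCA hu) (hδB ?_))
    rw [Metric.mem_ball, dist_zero_right, Real.norm_eq_abs]
    linarith
  obtain ⟨δ, hδ, C, hC, hCcl, hCD⟩ := key _ hDF
  have hmono : ∀ u ∈ C, StrictMonoOn (fun t : ℝ => f (u + t • h)) (Icc (-δ) δ) := by
    intro u hu
    have hder : ∀ t ∈ Icc (-δ) δ, HasDerivAt (fun t : ℝ => f (u + t • h)) (f' (u + t • h) h) t :=
      fun t ht => hasDerivAt_line (hf _ (hCD u hu t (abs_le.2 ht)).1 h)
    refine strictMonoOn_of_deriv_pos (convex_Icc _ _)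
      (fun t ht => (hder t ht).continuousAt.continuousWithinAt) fun t ht => ?_
    have ht' := interior_subset ht
    rw [(hder t ht').deriv]
    have h2 := hCD u hu t (abs_le.2 ht')
    simpa [e.right_inv h2.1] using (hDsub h2.2).2
  have hfc : ContinuousOn f e.target :=
    (hφ.comp_continuousOn e.continuousOn_symm).congr fun u _ => hfφ u
  generalize hc : f u₀ = c
  -- the level set is compact near `u₀`
  have hScomp : IsCompact {u | u ∈ C ∧ f u = c} := by
    apply IsSeqCompact.isCompact
    intro z hz
    have hchoice : ∀ i : ℕ, ∃ t : ℝ, 0 < t ∧ t ≤ δ ∧ t < 1 / ((i : ℝ) + 1) ∧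
        f (z i + t • h) < c + 1 / ((i : ℝ) + 1) := by
      intro i
      have hpi : (0 : ℝ) < 1 / ((i : ℝ) + 1) := by positivity
      have h0 := hCD (z i) (hz i).1 0 (by simpa using hδ.le)
      have hct : Tendsto (fun t : ℝ => f (z i + t • h)) (𝓝[>] 0) (𝓝 c) := by
        have h1 := (hasDerivAt_line (hf _ h0.1 h)).continuousAt.tendsto
        simp only [zero_smul, add_zero] at h1
        rw [← (hz i).2]
        exact h1.mono_left nhdsWithin_le_nhds
      have e1 := hct.eventually (gt_mem_nhds (show c < c + 1 / ((i : ℝ) + 1) by linarith))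
      have e2 : ∀ᶠ t : ℝ in 𝓝[>] 0, t < min δ (1 / ((i : ℝ) + 1)) :=
        mem_nhdsWithin_of_mem_nhds (gt_mem_nhds (lt_min hδ hpi))
      obtain ⟨t, ht1, ht2, ht3⟩ := (e1.and (e2.and self_mem_nhdsWithin)).exists
      exact ⟨t, ht3, (ht2.trans_le (min_le_left _ _)).le, ht2.trans_le (min_le_right _ _), ht1⟩
    choose t ht0 htδ ht1 htc using hchoice
    have htlim : Tendsto t atTop (𝓝 0) :=
      squeeze_zero (fun i => (ht0 i).le) (fun i => (ht1 i).le) tendsto_one_div_add_atTop_nhds_zero_nat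
    set y : ℕ → F := fun i => z i + t i • h with hy
    have hyD : ∀ i, y i ∈ e.target ∧ e.symm (y i) ∈ D := fun i =>
      hCD (z i) (hz i).1 (t i) (abs_le.2 ⟨by linarith [ht0 i], htδ i⟩)
    have hgt : ∀ i, c < f (y i) := by
      intro i
      have := hmono (z i) (hz i).1 ⟨by linarith, hδ.le⟩ ⟨by linarith [ht0 i], htδ i⟩ (ht0 i)
      simpa [(hz i).2] using this
    have hlim : Tendsto (fun i => φ (e.symm (y i))) atTop (𝓝 c) := by
      simp only [← hfφ]
      refine tendsto_of_tendsto_of_tendsto_of_le_of_le tendsto_const_nhds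
        (?_ : Tendsto (fun i : ℕ => c + 1 / ((i : ℝ) + 1)) atTop (𝓝 c))
        (fun i => (hgt i).le) (fun i => (htc i).le)
      simpa using tendsto_const_nhds.add (tendsto_one_div_add_atTop_nhds_zero_nat (𝕜 := ℝ))
    obtain ⟨w, hwc, hw⟩ := exists_mapClusterPt_of_isClosedMap hcl hlim fun i => hfφ (y i) ▸ (hgt i).ne'
    have hwD : w ∈ D := hDcl.mem_of_mapClusterPt hw (Eventually.of_forall fun i => (hyD i).2)
    have hws : w ∈ e.source := (hDsub hwD).1
    have hcl2 : MapClusterPt (e w) atTop (fun i => e (e.symm (y i))) :=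
      hw.continuousAt_comp (e.continuousAt hws)
    have hcl3 : MapClusterPt (e w) atTop y := by
      refine hcl2.congrFun (Eventually.of_forall fun i => e.right_inv (hyD i).1)
    obtain ⟨ψ, hψ, hψlim⟩ := hcl3.tendsto_subseq
    have hzlim : Tendsto (z ∘ ψ) atTop (𝓝 (e w)) := by
      have h1 : Tendsto (fun i => y (ψ i) - t (ψ i) • h) atTop (𝓝 (e w - (0 : ℝ) • h)) :=
        hψlim.sub ((htlim.comp hψ.tendsto_atTop).smul_const h)
      simpa [hy, Function.comp_def] using h1
    refine ⟨e w, ⟨hCcl.mem_of_tendsto hzlim (Eventually.of_forall fun i => (hz _).1), ?_⟩, ψ, hψ, hzlim⟩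
    rw [hfφ, e.left_inv hws, hwc]
  obtain ⟨δ', hδ', C', hC', -, hC'C⟩ := key C hC
  set d := min δ δ' with hd
  have hd0 : 0 < d := lt_min hδ hδ'
  have hdd : d ∈ Icc (-δ) δ := ⟨by linarith, min_le_left _ _⟩
  have hdd' : -d ∈ Icc (-δ) δ := ⟨by linarith [min_le_left δ δ'], by linarith⟩
  have hu₀C : u₀ ∈ C := mem_of_mem_nhds hC
  have hcont : ∀ s ∈ Icc (-δ) δ, Tendsto (fun u => f (u + s • h)) (𝓝 u₀) (𝓝 (f (u₀ + s • h))) := by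
    intro s hs
    have h1 : ContinuousAt f (u₀ + s • h) :=
      hfc.continuousAt (e.open_target.mem_nhds (hCD u₀ hu₀C s (abs_le.2 hs)).1)
    have h2 : ContinuousAt (fun u : F => u + s • h) u₀ := by fun_prop
    exact ContinuousAt.comp (f := fun u : F => u + s • h) (g := f) h1 h2
  have hup : c < f (u₀ + d • h) := by
    simpa [hc] using hmono u₀ hu₀C ⟨by linarith, hδ.le⟩ hdd hd0
  have hdown : f (u₀ + (-d) • h) < c := by
    simpa [hc] using hmono u₀ hu₀C hdd' ⟨by linarith, hδ.le⟩ (by linarith : -d < 0)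
  have himg : IsCompact ((fun p : F × ℝ => p.1 - p.2 • h) '' ({u | u ∈ C ∧ f u = c} ×ˢ Icc (-d) d)) :=
    (hScomp.prod isCompact_Icc).image (by fun_prop)
  have hnhds : (fun p : F × ℝ => p.1 - p.2 • h) '' ({u | u ∈ C ∧ f u = c} ×ˢ Icc (-d) d) ∈ 𝓝 u₀ := by
    filter_upwards [hC, hC', (hcont d hdd).eventually (lt_mem_nhds hup),
      (hcont (-d) hdd').eventually (gt_mem_nhds hdown)] with u huC huC' hu1 hu2
    have hcu : ContinuousOn (fun t : ℝ => f (u + t • h)) (Icc (-d) d) := by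
      intro t ht
      have ht' : t ∈ Icc (-δ) δ := ⟨hdd'.1.trans ht.1, ht.2.trans hdd.2⟩
      exact (hasDerivAt_line (hf _ (hCD u huC t (abs_le.2 ht')).1 h)).continuousAt.continuousWithinAt
    obtain ⟨t, ht, htc⟩ := intermediate_value_Icc (by linarith) hcu ⟨hu2.le, hu1.le⟩
    exact ⟨(u + t • h, t), ⟨⟨hC'C u huC' t ((abs_le.2 ht).trans (min_le_right _ _)), htc⟩, ht⟩,
      by simp⟩
  exact FiniteDimensional.of_totallyBounded_nhds ℝ hnhds himg.totallyBounded

/-- On a connected manifold, the model space of a non-constant closed `C_c^1` functional is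
finite-dimensional. -/
theorem finiteDimensional_of_isClosedMap [LocallyConvexSpace ℝ F] [ConnectedSpace M]
    [ChartedSpace F M] {φ : M → ℝ}
    (hφ : IsKellerC1Functional F φ) (hnonconst : ∃ x y, φ x ≠ φ y) (hcl : IsClosedMap φ) :
    FiniteDimensional ℝ F := by
  by_contra hinf
  have hzero : ∀ e ∈ atlas F M, ∀ u ∈ e.target, ∀ h : F,
      Tendsto (fun t : ℝ => t⁻¹ • (φ (e.symm (u + t • h)) - φ (e.symm u))) (𝓝[≠] 0) (𝓝 0) := by
    intro e he u hu h
    obtain ⟨f', hf, hf'⟩ := hφ.2 e he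
    by_cases h0 : f' u h = 0
    · have := hf u hu h
      rwa [h0] at this
    · exact absurd (finiteDimensional_of_deriv_ne_zero hφ.1 hcl e (fun _ => rfl) hf hf' hu h0) hinf
  have hlc : IsLocallyConstant φ := by
    rw [IsLocallyConstant.iff_eventually_eq]
    intro x
    set e := chartAt F x
    have hx := mem_chart_source F x
    obtain ⟨B, ⟨hB, hBc⟩, hBsub⟩ := (LocallyConvexSpace.convex_basis (𝕜 := ℝ) (e x)).mem_iff.1
      (e.open_target.mem_nhds (e.map_source hx))
    filter_upwards [e.open_source.mem_nhds hx, (e.continuousAt hx).preimage_mem_nhds hB]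
      with y hy hyB
    have hd : ∀ t ∈ Icc (0 : ℝ) 1,
        HasDerivAt (fun t : ℝ => φ (e.symm (e x + t • (e y - e x)))) 0 t := by
      intro t ht
      refine hasDerivAt_line (f := fun u => φ (e.symm u)) (f' := 0) ?_
      refine hzero e (chart_mem_atlas F x) _ (hBsub ?_) _
      exact hBc.add_smul_sub_mem (mem_of_mem_nhds hB) hyB ht
    have := constant_of_has_deriv_right_zero
      (fun t ht => (hd t ht).continuousAt.continuousWithinAt)
      (fun t ht => (hd t ⟨ht.1, ht.2.le⟩).hasDerivWithinAt) 1 (by simp)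
    simpa [e.left_inv hx, e.left_inv hy] using this
  obtain ⟨x, y, hxy⟩ := hnonconst
  exact hxy (hlc.apply_eq_of_preconnectedSpace x y)

end FiniteDim

/-! ### `C_c^1` maps over a finite-dimensional model space -/

/-- A norm on a finite-dimensional Hausdorff topological vector space, inducing the given uniform
structure definitionally. -/
@[reducible] noncomputable def finiteDimensionalNorm (F : Type*) [AddCommGroup F] [Module ℝ F]
    [u : UniformSpace F] [IsUniformAddGroup F] [ContinuousSMul ℝ F] [T2Space F]
    [FiniteDimensional ℝ F] : NormedAddCommGroup F :=
  { (inferInstance : AddCommGroup F),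
    (toEuclidean : F ≃L[ℝ] _).isUniformEmbedding.comapMetricSpace _ with
    norm := fun v => ‖(toEuclidean : F ≃L[ℝ] _) v‖
    dist_eq := fun v w => by
      change dist ((toEuclidean : F ≃L[ℝ] _) v) ((toEuclidean : F ≃L[ℝ] _) w) = _
      rw [dist_eq_norm, map_add, map_neg, ← norm_neg]
      congr 1
      abel }

theorem norm_smul_finiteDimensionalNorm (F : Type*) [AddCommGroup F] [Module ℝ F]
    [UniformSpace F] [IsUniformAddGroup F] [ContinuousSMul ℝ F] [T2Space F]
    [FiniteDimensional ℝ F] (a : ℝ) (v : F) :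
    letI := finiteDimensionalNorm F
    ‖a • v‖ ≤ ‖a‖ * ‖v‖ := by
  change ‖(toEuclidean : F ≃L[ℝ] _) (a • v)‖ ≤ ‖a‖ * ‖(toEuclidean : F ≃L[ℝ] _) v‖
  rw [map_smul, norm_smul]

theorem isOpen_selfMap_domain {F M : Type*} [TopologicalSpace F]
    [TopologicalSpace M] {f : M → M} (hf : Continuous f) (e e' : OpenPartialHomeomorph M F) :
    IsOpen (e.target ∩ e.symm ⁻¹' (f ⁻¹' e'.source)) :=
  e.symm.isOpen_inter_preimage (e'.open_source.preimage hf)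

section Normed

variable {F : Type*} [NormedAddCommGroup F] [NormedSpace ℝ F]
  {G : Type*} [NormedAddCommGroup G] [NormedSpace ℝ G]
  {M : Type*} [TopologicalSpace M]

/-- On a finite-dimensional space, Keller `C_c^1` maps are continuously differentiable in the usual
sense: pointwise continuity of the derivatives is continuity in norm, and the mean value inequality
turns directional derivatives into Fréchet derivatives. -/
theorem KellerC1On.contDiffOn [FiniteDimensional ℝ F] {f : F → G} {U : Set F}
    (hf : KellerC1On f U) (hU : IsOpen U) : ContDiffOn ℝ 1 f U := by
  obtain ⟨f', hd, hc⟩ := hf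
  let g : F → F →L[ℝ] G := fun x => (f' x : F →L[ℝ] G)
  have hgc : ContinuousOn g U := by
    rw [continuousOn_clm_apply]
    exact fun h => hc.eval_const h
  have hder : ∀ x ∈ U, HasFDerivAt f (g x) x := by
    intro x hx
    rw [hasFDerivAt_iff_isLittleO, Asymptotics.isLittleO_iff]
    intro ε hε
    obtain ⟨r, hr, hrU⟩ := Metric.mem_nhds_iff.1 (inter_mem (hU.mem_nhds hx)
      ((hgc.continuousAt (hU.mem_nhds hx)).eventually (Metric.ball_mem_nhds _ hε)))
    filter_upwards [Metric.ball_mem_nhds x hr] with y hy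
    have hseg : ∀ t ∈ Icc (0 : ℝ) 1, x + t • (y - x) ∈ Metric.ball x r := fun t ht =>
      (convex_ball x r).add_smul_sub_mem (Metric.mem_ball_self hr) hy ht
    have h1 : ∀ t ∈ Icc (0 : ℝ) 1, HasDerivWithinAt
        (fun t : ℝ => f (x + t • (y - x)) - t • g x (y - x))
        (g (x + t • (y - x)) (y - x) - g x (y - x)) (Icc 0 1) t := by
      intro t ht
      have h2 := hasDerivAt_line (f' := f') (hd _ (hrU (hseg t ht)).1 (y - x))
      have h3 := (hasDerivAt_id t).smul_const (g x (y - x))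
      rw [one_smul] at h3
      exact (h2.sub h3).hasDerivWithinAt
    have h4 := norm_image_sub_le_of_norm_deriv_le_segment_01' h1
      (C := ε * ‖y - x‖) (fun t ht => by
        have h5 := (hrU (hseg t ⟨ht.1, ht.2.le⟩)).2
        change dist _ _ < ε at h5
        rw [dist_eq_norm] at h5
        rw [← sub_apply]
        exact (ContinuousLinearMap.le_opNorm _ _).trans
          (mul_le_mul_of_nonneg_right h5.le (norm_nonneg _)))
    simp only [one_smul, zero_smul, add_zero, sub_zero, add_sub_cancel] at h4
    rwa [sub_right_comm] at h4
  have hfd : EqOn (fderiv ℝ f) g U := fun x hx => (hder x hx).fderiv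
  rw [← zero_add (1 : WithTop ℕ∞), contDiffOn_succ_iff_fderiv_of_isOpen hU]
  exact ⟨fun x hx => (hder x hx).differentiableAt.differentiableWithinAt, by simp,
    contDiffOn_zero.2 (hgc.congr hfd)⟩

theorem KellerC1On.contDiffAt [FiniteDimensional ℝ F] {f : F → G} {U : Set F}
    (hf : KellerC1On f U) (hU : IsOpen U) {x : F} (hx : x ∈ U) : ContDiffAt ℝ 1 f x :=
  (hf.contDiffOn hU).contDiffAt (hU.mem_nhds hx)

theorem _root_.ContDiffAt.hasFDerivAt_fderiv {f : F → G} {x : F} (h : ContDiffAt ℝ 1 f x) :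
    HasFDerivAt f (fderiv ℝ f x) x :=
  (h.differentiableAt one_ne_zero).hasFDerivAt

theorem _root_.HasFDerivAt.dirDeriv_eq {f : F → G} {f' : F →L[ℝ] G} {x : F}
    (hf : HasFDerivAt f f' x) (h : F) : dirDeriv f x h = f' h :=
  FrechetLS.dirDeriv_eq (hf.hasLineDerivAt h).tendsto_slope_zero

/-- The chain rule for a map `f ∘ g` on a manifold, read in a chart `e` at `y` and in a chart `a`
at `g y`. -/
theorem hasFDerivAt_comp_charts {N : Type*} [TopologicalSpace N] {f : N → G} {g : M → N}
    {e : OpenPartialHomeomorph M F}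
    {a : OpenPartialHomeomorph N F} {y : M} (hy : y ∈ e.source) (hgy : g y ∈ a.source)
    (hg : ContinuousAt g y) {D : F →L[ℝ] G} {D' : F →L[ℝ] F}
    (hD : HasFDerivAt (fun z => f (a.symm z)) D (a (g y)))
    (hD' : HasFDerivAt (fun z => a (g (e.symm z))) D' (e y)) :
    HasFDerivAt (fun z => f (g (e.symm z))) (D.comp D') (e y) := by
  have h1 : HasFDerivAt (fun z => f (a.symm z)) D ((fun z => a (g (e.symm z))) (e y)) := by
    simpa [e.left_inv hy] using hD
  refine (h1.comp (e y) hD').congr_of_eventuallyEq ?_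
  have hs : Tendsto (fun z => g (e.symm z)) (𝓝 (e y)) (𝓝 (g y)) :=
    hg.tendsto.comp (e.tendsto_symm hy)
  filter_upwards [hs.eventually (a.open_source.mem_nhds hgy)] with z hz
  simp only [Function.comp_apply, a.left_inv hz]

variable [ChartedSpace F M] [FiniteDimensional ℝ F]

theorem IsKellerC1SelfMap.contDiffAt {f : M → M} (hf : IsKellerC1SelfMap F f)
    {e e' : OpenPartialHomeomorph M F} (he : e ∈ atlas F M) (he' : e' ∈ atlas F M) {x : M}
    (hx : x ∈ e.source) (hfx : f x ∈ e'.source) :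
    ContDiffAt ℝ 1 (fun z => e' (f (e.symm z))) (e x) :=
  (hf.2 e he e' he').contDiffAt (isOpen_selfMap_domain hf.1 e e')
    ⟨e.map_source hx, by simpa [e.left_inv hx] using hfx⟩

theorem IsKellerC1Functional.contDiffAt {φ : M → ℝ} (hφ : IsKellerC1Functional F φ)
    {e : OpenPartialHomeomorph M F} (he : e ∈ atlas F M) {x : M} (hx : x ∈ e.source) :
    ContDiffAt ℝ 1 (fun z => φ (e.symm z)) (e x) :=
  (hφ.2 e he).contDiffAt e.open_target (e.map_source hx)

theorem IsKellerManifold.contDiffAt (hM : IsKellerManifold F M)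
    {e e' : OpenPartialHomeomorph M F} (he : e ∈ atlas F M) (he' : e' ∈ atlas F M) {x : M}
    (hx : x ∈ e.source) (hx' : x ∈ e'.source) :
    ContDiffAt ℝ 1 (fun z => e' (e.symm z)) (e x) :=
  (hM e he e' he').contDiffAt (e.symm.trans e').open_source
    ⟨e.map_source hx, by simpa [e.left_inv hx] using hx'⟩

theorem IsKellerChart.contDiffAt_left {e : OpenPartialHomeomorph M F} (h : IsKellerChart e)
    {e' : OpenPartialHomeomorph M F} (he' : e' ∈ atlas F M) {x : M}
    (hx : x ∈ e.source) (hx' : x ∈ e'.source) :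
    ContDiffAt ℝ 1 (fun z => e' (e.symm z)) (e x) :=
  (h e' he').1.contDiffAt (e.symm.trans e').open_source
    ⟨e.map_source hx, by simpa [e.left_inv hx] using hx'⟩

theorem IsKellerChart.contDiffAt_right {e : OpenPartialHomeomorph M F} (h : IsKellerChart e)
    {e' : OpenPartialHomeomorph M F} (he' : e' ∈ atlas F M) {x : M}
    (hx : x ∈ e.source) (hx' : x ∈ e'.source) :
    ContDiffAt ℝ 1 (fun z => e (e'.symm z)) (e' x) :=
  (h e' he').2.contDiffAt (e'.symm.trans e).open_source
    ⟨e'.map_source hx', by simpa [e'.left_inv hx'] using hx⟩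

/-! ### The critical set -/

/-- A point is critical as soon as the derivative of the functional in some chart of the atlas
vanishes. -/
theorem differential_eq_zero_iff (hM : IsKellerManifold F M) {φ : M → ℝ}
    (hφ : IsKellerC1Functional F φ) {a : OpenPartialHomeomorph M F} (ha : a ∈ atlas F M) {x : M}
    (hx : x ∈ a.source) :
    (∀ h, differential F φ x h = 0) ↔ fderiv ℝ (fun z => φ (a.symm z)) (a x) = 0 := by
  have hc := mem_chart_source F x
  have hca := chart_mem_atlas F x
  have h1 : ∀ h, differential F φ x h =
      fderiv ℝ (fun z => φ ((chartAt F x).symm z)) (chartAt F x x) h := fun h =>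
    (hφ.contDiffAt hca hc).hasFDerivAt_fderiv.dirDeriv_eq h
  have aux : ∀ {a b : OpenPartialHomeomorph M F}, a ∈ atlas F M → b ∈ atlas F M → x ∈ a.source →
      x ∈ b.source → fderiv ℝ (fun z => φ (a.symm z)) (a x) = 0 →
      fderiv ℝ (fun z => φ (b.symm z)) (b x) = 0 := by
    intro a b ha hb hxa hxb h0
    have := hasFDerivAt_comp_charts (g := id) hxb hxa continuousAt_id
      (hφ.contDiffAt ha hxa).hasFDerivAt_fderiv (hM.contDiffAt hb ha hxb hxa).hasFDerivAt_fderiv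
    rw [h0, ContinuousLinearMap.zero_comp] at this
    exact this.fderiv
  constructor
  · intro h
    refine aux hca ha hc hx (ContinuousLinearMap.ext fun v => ?_)
    rw [← h1, h v, zero_apply]
  · intro h v
    rw [h1, aux ha hca hx hc h, zero_apply]

theorem isClosed_criticalSet (hM : IsKellerManifold F M) {φ : M → ℝ}
    (hφ : IsKellerC1Functional F φ) (c : ℝ) : IsClosed (criticalSet F φ c) := by
  refine IsClosed.inter (s₁ := {x | ∀ h : F, differential F φ x h = 0}) ?_
    (isClosed_eq hφ.1 continuous_const)
  rw [← isOpen_compl_iff, isOpen_iff_mem_nhds]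
  intro x hx
  set a := chartAt F x
  have hxa := mem_chart_source F x
  have ha := chart_mem_atlas F x
  have hx0 : fderiv ℝ (fun z => φ (a.symm z)) (a x) ≠ 0 := fun h =>
    hx ((differential_eq_zero_iff hM hφ ha hxa).2 h)
  have hcont : ContinuousAt (fun y => fderiv ℝ (fun z => φ (a.symm z)) (a y)) x :=
    ContinuousAt.comp (f := a) (((hφ.contDiffAt ha hxa).fderiv_right le_rfl).continuousAt (n := 0))
      (a.continuousAt hxa)
  filter_upwards [a.open_source.mem_nhds hxa, hcont.eventually_ne hx0] with y hy hy0
  exact fun h => hy0 ((differential_eq_zero_iff hM hφ ha hy).1 h)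

theorem isInvariantSet_criticalSet {L : Type*} [Group L] [MulAction L M]
    (hM : IsKellerManifold F M) {φ : M → ℝ} (hφ : IsKellerC1Functional F φ)
    (hact : ∀ l : L, IsKellerC1SelfMap F (fun x : M => l • x))
    (hinv : ∀ (l : L) (x : M), φ (l • x) = φ x) (c : ℝ) :
    IsInvariantSet L (criticalSet F φ c) := by
  rintro l x ⟨hx, hxc⟩
  refine ⟨?_, by rw [hinv, hxc]⟩
  have ha := chart_mem_atlas F x
  have hb := chart_mem_atlas F (l • x)
  have hxa := mem_chart_source F x
  have hxb := mem_chart_source F (l • x)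
  have hla : l⁻¹ • l • x ∈ (chartAt F x).source := by rwa [inv_smul_smul]
  rw [differential_eq_zero_iff hM hφ ha hxa] at hx
  rw [differential_eq_zero_iff hM hφ hb hxb]
  have := hasFDerivAt_comp_charts (f := φ) (g := fun y => l⁻¹ • y) hxb hla (hact l⁻¹).1.continuousAt
    (hφ.contDiffAt ha hla).hasFDerivAt_fderiv
    ((hact l⁻¹).contDiffAt hb ha hxb hla).hasFDerivAt_fderiv
  simp only [hinv, inv_smul_smul, hx, ContinuousLinearMap.zero_comp] at this
  exact this.fderiv

end Normed

/-! ### Compactness from sequences in a developable space -/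

/-- Let `V k x` be neighbourhoods of the points, shrinking as `k` grows, uniformly near each point.
Then a set in which every sequence accumulates is compact: for each `k` it is covered by finitely
many of the sets `V k x`, and every open cover has a Lebesgue index `k`. -/
theorem isCompact_of_development {X : Type*} [TopologicalSpace X] {V : ℕ → X → Set X}
    (h1 : ∀ k x, ∀ᶠ p : X × X in 𝓝 (x, x), p.2 ∈ V k p.1)
    (h2 : ∀ x, ∀ U ∈ 𝓝 x, ∃ K, ∀ᶠ y in 𝓝 x, ∀ k ≥ K, V k y ⊆ U) {S : Set X}
    (hS : ∀ u : ℕ → X, (∀ i, u i ∈ S) → ∃ x ∈ S, MapClusterPt x atTop u) : IsCompact S := by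
  refine isCompact_of_finite_subcover fun {ι} U hUo hSU => ?_
  obtain ⟨k, hk⟩ : ∃ k, ∀ x ∈ S, ∃ i, V k x ⊆ U i := by
    by_contra! hcon
    choose u huS hu using hcon
    obtain ⟨x, hxS, hx⟩ := hS u huS
    obtain ⟨i, hi⟩ := mem_iUnion.1 (hSU hxS)
    obtain ⟨K, hK⟩ := h2 x _ ((hUo i).mem_nhds hi)
    obtain ⟨j, hj, hjK⟩ := ((hx.frequently hK).and_eventually (eventually_ge_atTop K)).exists
    exact hu j i (hj j hjK)
  obtain ⟨t, htS, ht⟩ : ∃ t : Finset X, (∀ x ∈ t, x ∈ S) ∧ ∀ y ∈ S, ∃ x ∈ t, y ∈ V k x := by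
    by_contra! hcon
    obtain ⟨u, huS, hu⟩ := exists_seq_of_forall_finset_exists (fun x => x ∈ S)
      (fun x y => y ∉ V k x) hcon
    obtain ⟨x, hxS, hx⟩ := hS u huS
    have h3 : ∃ W ∈ 𝓝 x, ∀ a ∈ W, ∀ b ∈ W, b ∈ V k a := by
      obtain ⟨A, hA, B, hB, hAB⟩ := mem_nhds_prod_iff.1 (h1 k x)
      exact ⟨A ∩ B, inter_mem hA hB, fun a ha b hb => hAB (mk_mem_prod ha.1 hb.2)⟩
    obtain ⟨W, hW, hWV⟩ := h3
    have hfr := hx.frequently hW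
    obtain ⟨i, hi⟩ := hfr.exists
    obtain ⟨j, hj, hij⟩ := (hfr.and_eventually (eventually_gt_atTop i)).exists
    exact hu i j hij (hWV _ hi _ hj)
  choose i hi using fun x : t => hk x (htS x x.2)
  classical
  refine ⟨Finset.univ.image i, fun y hy => ?_⟩
  obtain ⟨x, hx, hxy⟩ := ht y hy
  exact mem_iUnion₂.2 ⟨i ⟨x, hx⟩, Finset.mem_image_of_mem i (Finset.mem_univ _), hi ⟨x, hx⟩ hxy⟩

/-! ### Short segments for a Finsler structure -/

theorem FinslerStructure.slopeFunction_eq_zero {F : Type*} [NormedAddCommGroup F]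
    [NormedSpace ℝ F] {M : Type*} [TopologicalSpace M] [ChartedSpace F M] (N : FinslerStructure F M)
    {φ : M → ℝ} {x : M} (h : ∀ v : F, differential F φ x v = 0) :
    N.slopeFunction φ x = 0 := by
  have h1 : differential F φ x '' N.unitBall x ⊆ {0} := by
    rintro _ ⟨v, -, rfl⟩
    exact h v
  rcases subset_singleton_iff_eq.1 h1 with h2 | h2 <;> simp [slopeFunction, h2]

section Finsler

variable {F : Type*} [NormedAddCommGroup F] [NormedSpace ℝ F] [FiniteDimensional ℝ F]
  {M : Type*} [TopologicalSpace M] [ChartedSpace F M]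

/-- The cocycle condition for the coordinate changes of tangent vectors. -/
theorem kellerCoordChange_trans {e e' : OpenPartialHomeomorph M F} (he : IsKellerChart e)
    (he' : IsKellerChart e') {a : OpenPartialHomeomorph M F} (ha : a ∈ atlas F M) {y : M}
    (hy : y ∈ e.source) (hy' : y ∈ e'.source) (hya : y ∈ a.source) (v : F) :
    ∃ D : F →L[ℝ] F, HasFDerivAt (fun z => e (e'.symm z)) D (e' y) ∧
      kellerCoordChange e a y (D v) = kellerCoordChange e' a y v := by
  have h1 := hasFDerivAt_comp_charts (g := id) hy' hya continuousAt_id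
    (he.contDiffAt_right ha hy hya).hasFDerivAt_fderiv
    (he'.contDiffAt_left ha hy' hya).hasFDerivAt_fderiv
  have h2 := (he.contDiffAt_left ha hy hya).hasFDerivAt_fderiv
  have h3 := hasFDerivAt_comp_charts (g := id) hy' hy continuousAt_id h2 h1
  refine ⟨_, h1, ?_⟩
  exact (h2.dirDeriv_eq _).trans (h3.dirDeriv_eq v).symm

namespace FinslerStructure

variable (N : FinslerStructure F M)

/-- The points joined to `y` by a straight segment, in some chart, along which the `k`-th component
of the Finsler structure is at most `1 / (k + 1)` on the velocity. -/
def segmentNhd (k : ℕ) (y : M) : Set M :=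
  {z | ∃ e : OpenPartialHomeomorph M F, IsKellerChart e ∧ y ∈ e.source ∧ z ∈ e.source ∧
    ∀ t ∈ Icc (0 : ℝ) 1, e y + t • (e z - e y) ∈ e.target ∧
      N.nrm k (e.symm (e y + t • (e z - e y)))
        (kellerCoordChange e (chartAt F (e.symm (e y + t • (e z - e y))))
          (e.symm (e y + t • (e z - e y))) (e z - e y)) ≤ 1 / ((k : ℝ) + 1)}

omit [FiniteDimensional ℝ F] in
theorem eventually_mem_segmentNhd (k : ℕ) (x : M) :
    ∀ᶠ p : M × M in 𝓝 (x, x), p.2 ∈ N.segmentNhd k p.1 := by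
  obtain ⟨e, he, hx, hq⟩ := N.locally_trivial x
  let q : M → F → ℝ := fun y v => N.nrm k y (kellerCoordChange e (chartAt F y) y v)
  have h0 : q x 0 = 0 := by
    obtain ⟨p, hp, -⟩ := hq.seminorms x hx
    exact (hp k 0).symm.trans (map_zero _)
  have hcont : ContinuousAt (fun z : M × F => q z.1 z.2) (x, 0) :=
    (hq.continuousOn k).continuousAt (prod_mem_nhds (e.open_source.mem_nhds hx) univ_mem)
  have hsmall : ∀ᶠ z : M × F in 𝓝 (x, 0), q z.1 z.2 < 1 / ((k : ℝ) + 1) :=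
    hcont.eventually (gt_mem_nhds (by simp only [h0]; positivity))
  obtain ⟨A, hA, B, hB, hAB⟩ := mem_nhds_prod_iff.1 hsmall
  have hT : ∀ᶠ u in 𝓝 (e x), u ∈ e.target ∧ e.symm u ∈ A :=
    (e.open_target.eventually_mem (e.map_source hx)).and
      ((e.tendsto_symm hx).eventually hA)
  obtain ⟨r, hr, hrT⟩ := Metric.mem_nhds_iff.1 hT
  have hsub : Tendsto (fun p : M × M => e p.2 - e p.1) (𝓝 (x, x)) (𝓝 0) := by
    have h1 : Tendsto (fun p : M × M => e p.1) (𝓝 (x, x)) (𝓝 (e x)) :=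
      (e.continuousAt hx).tendsto.comp continuousAt_fst
    have h2 : Tendsto (fun p : M × M => e p.2) (𝓝 (x, x)) (𝓝 (e x)) :=
      (e.continuousAt hx).tendsto.comp continuousAt_snd
    simpa using h2.sub h1
  have hball : ∀ᶠ y in 𝓝 x, y ∈ e.source ∧ e y ∈ Metric.ball (e x) r :=
    (e.open_source.eventually_mem hx).and
      ((e.continuousAt hx).eventually (Metric.ball_mem_nhds _ hr))
  filter_upwards [hsub.eventually hB, hball.prod_mk hball |>.filter_mono nhds_prod_eq.le]
    with p hpB hp
  refine ⟨e, he, hp.1.1, hp.2.1, fun t ht => ?_⟩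
  have hu := hrT ((convex_ball (e x) r).add_smul_sub_mem hp.1.2 hp.2.2 ht)
  exact ⟨hu.1, (hAB (mk_mem_prod hu.2 hpB)).le⟩

/-- Near `x`, the short segments stay in any given neighbourhood `U` of `x`: as long as such a
segment stays in a chart domain around `x`, the comparison condition bounds its speed in that
chart. -/
theorem exists_segmentNhd_subset [T3Space M] (hgraded : N.IsGraded) (x : M) {U : Set M}
    (hU : U ∈ 𝓝 x) : ∃ K, ∀ᶠ y in 𝓝 x, ∀ k ≥ K, N.segmentNhd k y ⊆ U := by
  have hmono : ∀ y v, Monotone fun n => N.nrm n y v := fun y v =>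
    monotone_nat_of_le_succ fun n => hgraded n y v
  obtain ⟨e, he, hx, hq⟩ := N.locally_trivial x
  obtain ⟨W, hW, hWq⟩ := hq.comparison 2 (by norm_num) x hx
  obtain ⟨p, hpq, hp⟩ := hq.seminorms x hx
  obtain ⟨C, hC, hCcl, hCsub⟩ := exists_mem_nhds_isClosed_subset
    (inter_mem hU (inter_mem hW (e.open_source.mem_nhds hx)))
  have hT : ∀ᶠ u in 𝓝 (e x), u ∈ e.target ∧ e.symm u ∈ C :=
    (e.open_target.eventually_mem (e.map_source hx)).and ((e.tendsto_symm hx).eventually hC)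
  obtain ⟨s, r, hr, hsr⟩ := (hp.mem_nhds_iff _ _).1 hT
  obtain ⟨n, hn⟩ : ∃ n, ∀ u, p n (u - e x) < r → u ∈ e.target ∧ e.symm u ∈ C := by
    refine ⟨s.sup id, fun u hu => hsr ?_⟩
    have hle : s.sup p ≤ p (s.sup id) := by
      refine Finset.sup_le fun i hi v => ?_
      rw [hpq, hpq]
      exact hmono _ _ (Finset.le_sup (f := id) hi)
    exact (hle (u - e x)).trans_lt hu
  have hpc : Continuous (p n) := hp.continuous_seminorm n
  obtain ⟨K, hK⟩ := exists_nat_gt (8 / r)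
  refine ⟨max n K, ?_⟩
  have hclose : ∀ᶠ y in 𝓝 x, p n (e y - e x) < r / 2 := by
    have h1 : ContinuousAt (fun y => p n (e y - e x)) x :=
      ContinuousAt.comp (g := fun u => p n (u - e x)) (f := e) (by fun_prop) (e.continuousAt hx)
    refine h1.eventually (gt_mem_nhds ?_)
    simp only [sub_self, map_zero]
    positivity
  filter_upwards [hclose, e.open_source.mem_nhds hx] with y hy hys k hk z hz
  obtain ⟨e', he', hy', hz', hseg⟩ := hz
  set h := e' z - e' y with hh
  set γ : ℝ → M := fun t => e'.symm (e' y + t • h) with hγ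
  set a : ℝ := 1 / ((k : ℝ) + 1) with ha
  have ha0 : 0 < a := by positivity
  have har : 4 * a ≤ r / 2 := by
    have h1 : (K : ℝ) ≤ k := by exact_mod_cast (le_max_right n K).trans hk
    have h2 : 8 / r < (k : ℝ) + 1 := by linarith
    rw [div_lt_iff₀ hr] at h2
    rw [ha, mul_one_div, div_le_div_iff₀ (by positivity) (by positivity)]
    linarith
  have hγcont : ContinuousOn γ (Icc 0 1) := by
    refine e'.continuousOn_symm.comp (by fun_prop) fun t ht => (hseg t ht).1
  have hγ0 : γ 0 = y := by simp [hγ, e'.left_inv hy']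
  have hγ1 : γ 1 = z := by simp [hγ, hh, e'.left_inv hz']
  -- the bound is propagated along the segment with speed `4 a`, twice what the comparison condition
  -- gives, so that it persists for a short time after each `t` at which it holds
  suffices hmain : Icc (0 : ℝ) 1 ⊆ {t | γ t ∈ C ∧ p n (e (γ t) - e y) - t * (4 * a) ≤ 0} by
    have := (hmain (right_mem_Icc.2 zero_le_one)).1
    rw [hγ1] at this
    exact (hCsub this).1
  refine IsClosed.Icc_subset_of_forall_mem_nhdsWithin ?_ ?_ ?_
  · have hT : IsClosed (Icc (0 : ℝ) 1 ∩ γ ⁻¹' C) :=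
      hγcont.preimage_isClosed_of_isClosed isClosed_Icc hCcl
    have hcont : ContinuousOn (fun t => p n (e (γ t) - e y) - t * (4 * a))
        (Icc (0 : ℝ) 1 ∩ γ ⁻¹' C) := by
      have h1 : ContinuousOn (fun t => e (γ t)) (Icc (0 : ℝ) 1 ∩ γ ⁻¹' C) :=
        e.continuousOn.comp (hγcont.mono inter_subset_left) fun t ht => (hCsub ht.2).2.2
      exact (hpc.comp_continuousOn (h1.sub continuousOn_const)).sub (by fun_prop)
    have := hcont.preimage_isClosed_of_isClosed hT isClosed_Iic (t := Iic (0 : ℝ))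
    convert this using 1
    ext t
    exact ⟨fun h => ⟨⟨h.2, h.1.1⟩, h.1.2⟩, fun h => ⟨⟨h.1.2, h.2⟩, h.1.1⟩⟩
  · refine ⟨?_, by simp [hγ0]⟩
    rw [hγ0]
    have := (hn (e y) (by linarith)).2
    rwa [e.left_inv hys] at this
  · rintro t ⟨⟨htC, htp⟩, ht⟩
    have htI : t ∈ Icc (0 : ℝ) 1 := ⟨ht.1, ht.2.le⟩
    obtain ⟨htT, hta⟩ := hseg t htI
    have hts : γ t ∈ e.source := (hCsub htC).2.2
    have hts' : γ t ∈ e'.source := e'.map_target htT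
    obtain ⟨D, hD, hDh⟩ := kellerCoordChange_trans he he' (chart_mem_atlas F (γ t)) hts hts'
      (mem_chart_source F (γ t)) h
    have hspeed : p n (D h) ≤ 2 * a := by
      have h1 := (hWq (γ t) ⟨(hCsub htC).2.1, hts⟩ n (D h)).1
      have h2 : N.nrm n (γ t) (kellerCoordChange e (chartAt F (γ t)) (γ t) (D h)) ≤ a := by
        rw [hDh]
        exact (hmono _ _ ((le_max_left n K).trans hk)).trans hta
      rw [hpq]
      linarith
    have hder : HasDerivAt (fun t => e (γ t)) (D h) t := by
      have hD' : HasFDerivAt (fun z => e (e'.symm z)) D (e' y + t • h) := by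
        rwa [hγ, e'.right_inv htT] at hD
      have hl : HasDerivAt (fun t : ℝ => e' y + t • h) h t := by
        simpa using ((hasDerivAt_id t).smul_const h).const_add (e' y)
      exact hD'.comp_hasDerivAt t hl
    have hslope := hpc.continuousAt.tendsto.comp
      (hasDerivAt_iff_tendsto_slope.1 hder)
    have hslope' := (hslope.mono_left (nhdsWithin_mono t (fun s (hs : t < s) => hs.ne'))).eventually
      (gt_mem_nhds (show p n (D h) < 4 * a by linarith))
    have hin : ∀ᶠ s in 𝓝[>] t, γ s ∈ e.source ∧ p n (e (γ s) - e x) < r := by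
      refine mem_nhdsWithin_of_mem_nhds ?_
      have hγt : ContinuousAt γ t := by
        refine ContinuousAt.comp (g := e'.symm) (f := fun t : ℝ => e' y + t • h)
          (e'.continuousAt_symm htT) (by fun_prop)
      have h1 : ContinuousAt (fun s => p n (e (γ s) - e x)) t := by
        refine ContinuousAt.comp (g := fun u => p n (u - e x)) (f := fun s => e (γ s))
          (by fun_prop) hder.continuousAt
      refine (hγt.eventually (e.open_source.mem_nhds hts)).and (h1.eventually (gt_mem_nhds ?_))
      have h2 : p n (e (γ t) - e x) ≤ p n (e (γ t) - e y) + p n (e y - e x) := by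
        rw [← sub_add_sub_cancel (e (γ t)) (e y) (e x)]
        exact map_add_le_add _ _ _
      have h3 : t * (4 * a) ≤ 4 * a := by nlinarith [ht.2]
      linarith
    filter_upwards [hslope', hin, self_mem_nhdsWithin] with s hs1 hs2 hs3
    have hst : 0 < s - t := sub_pos.2 hs3
    refine ⟨?_, ?_⟩
    · have := (hn _ hs2.2).2
      rwa [e.left_inv hs2.1] at this
    · simp only [Function.comp_apply, slope, vsub_eq_sub, map_smul_eq_mul, norm_inv,
        Real.norm_eq_abs, abs_of_pos hst] at hs1
      rw [inv_mul_lt_iff₀ hst] at hs1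
      have h2 : p n (e (γ s) - e y) ≤ p n (e (γ s) - e (γ t)) + p n (e (γ t) - e y) := by
        rw [← sub_add_sub_cancel (e (γ s)) (e (γ t)) (e y)]
        exact map_add_le_add _ _ _
      linarith

/-! ### Compactness of the level sets -/

theorem frequently_ne_of_not_critical (hM : IsKellerManifold F M) {φ : M → ℝ}
    (hφ : IsKellerC1Functional F φ) {c : ℝ} {x : M} (hxc : φ x = c)
    (hx : x ∉ criticalSet F φ c) : ∃ᶠ y in 𝓝 x, φ y ≠ c := by
  intro hcon
  simp only [not_not] at hcon
  refine hx ⟨?_, hxc⟩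
  have hxs := mem_chart_source F x
  rw [differential_eq_zero_iff hM hφ (chart_mem_atlas F x) hxs]
  have h1 : (fun z => φ ((chartAt F x).symm z)) =ᶠ[𝓝 (chartAt F x x)] fun _ => c :=
    ((chartAt F x).tendsto_symm hxs).eventually hcon
  rw [h1.fderiv_eq]
  exact fderiv_const_apply c

/-- At a Palais–Smale level the whole level set of a closed functional is compact: sequences of
critical points accumulate by the Palais–Smale condition, and a sequence of regular points can be
approximated by points at nearby levels, which accumulate because the functional is closed. -/
theorem isCompact_level [T3Space M] (hM : IsKellerManifold F M) (hgraded : N.IsGraded) {φ : M → ℝ}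
    (hφ : IsKellerC1Functional F φ) (hcl : IsClosedMap φ) {c : ℝ} (hPS : N.PalaisSmale φ c) :
    IsCompact {x | φ x = c} := by
  refine isCompact_of_development (V := N.segmentNhd) N.eventually_mem_segmentNhd
    (fun x U hU => N.exists_segmentNhd_subset hgraded x hU) fun u hu => ?_
  by_cases hfr : ∃ᶠ i in atTop, u i ∈ criticalSet F φ c
  · obtain ⟨ψ, hψ, hψc⟩ := extraction_of_frequently_atTop hfr
    obtain ⟨x, s, hs, hlim⟩ := hPS (u ∘ ψ)
      (tendsto_const_nhds.congr fun i => (hψc i).2.symm)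
      (tendsto_const_nhds.congr fun i => (N.slopeFunction_eq_zero (hψc i).1).symm)
    refine ⟨x, ?_, ?_⟩
    · exact (isClosed_eq hφ.1 continuous_const).mem_of_tendsto hlim
        (Eventually.of_forall fun i => hu _)
    · exact (hlim.mapClusterPt.of_comp hs.tendsto_atTop).of_comp hψ.tendsto_atTop
  · rw [not_frequently, eventually_atTop] at hfr
    obtain ⟨n, hn⟩ := hfr
    have hch : ∀ i : ℕ, ∃ y, φ y ≠ c ∧ u (i + n) ∈ N.segmentNhd i y ∧
        dist (φ y) c < 1 / ((i : ℝ) + 1) := by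
      intro i
      have e1 := frequently_ne_of_not_critical hM hφ (hu (i + n)) (hn _ (Nat.le_add_left n i))
      have e2 : ∀ᶠ y in 𝓝 (u (i + n)), u (i + n) ∈ N.segmentNhd i y :=
        (Continuous.prodMk_left (u (i + n))).continuousAt.eventually
          (N.eventually_mem_segmentNhd i (u (i + n)))
      have e3 : ∀ᶠ y in 𝓝 (u (i + n)), dist (φ y) c < 1 / ((i : ℝ) + 1) := by
        have := hφ.1.continuousAt (x := u (i + n))
        rw [ContinuousAt, show φ (u (i + n)) = c from hu _] at this
        exact this.eventually (Metric.ball_mem_nhds c (by positivity))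
      exact (e1.and_eventually (e2.and e3)).exists
    choose y hy1 hy2 hy3 using hch
    have hlim : Tendsto (fun i => φ (y i)) atTop (𝓝 c) :=
      tendsto_iff_dist_tendsto_zero.2 (squeeze_zero (fun _ => dist_nonneg) (fun i => (hy3 i).le)
        tendsto_one_div_add_atTop_nhds_zero_nat)
    obtain ⟨z, hzc, hz⟩ := exists_mapClusterPt_of_isClosedMap hcl hlim hy1
    refine ⟨z, hzc, ?_⟩
    have hz' : MapClusterPt z atTop (fun i => u (i + n)) := by
      rw [mapClusterPt_iff_frequently]
      intro U hU
      obtain ⟨K, hK⟩ := N.exists_segmentNhd_subset hgraded z hU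
      refine ((hz.frequently hK).and_eventually (eventually_ge_atTop K)).mono fun i hi => ?_
      exact hi.1 i hi.2 (hy2 i)
    exact hz'.of_comp (tendsto_add_atTop_nat n)

end FinslerStructure

end Finsler

/-! ### Joint continuity of the derivatives of the action -/

section Action

variable {F : Type*} [NormedAddCommGroup F] [NormedSpace ℝ F]
  {M : Type*} [TopologicalSpace M]
  {L : Type*} [Group L] [MulAction L M]

/-- The derivative at `x` of the transformation `l`, read in the chart `e` both at `x` and at
`l • x`. It is meaningful only if both points belong to the domain of `e`. -/
noncomputable def actDeriv (e : OpenPartialHomeomorph M F) (l : L) (x : M) : F →L[ℝ] F :=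
  fderiv ℝ (fun z => e (l • e.symm z)) (e x)

/-- The transformations `l ∈ L` are continuously differentiable in the chart `e`. -/
def IsC1ActionIn (L : Type*) [Group L] [MulAction L M] (e : OpenPartialHomeomorph M F) : Prop :=
  ∀ (l : L), ∀ x ∈ e.source, l • x ∈ e.source → ContDiffAt ℝ 1 (fun z => e (l • e.symm z)) (e x)

variable {e : OpenPartialHomeomorph M F}

theorem IsC1ActionIn.hasFDerivAt (he : IsC1ActionIn L e) {l : L} {x : M} (hx : x ∈ e.source)
    (hlx : l • x ∈ e.source) :
    HasFDerivAt (fun z => e (l • e.symm z)) (actDeriv e l x) (e x) :=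
  (he l x hx hlx).hasFDerivAt_fderiv

/-- The chain rule for a product of transformations. -/
theorem IsC1ActionIn.actDeriv_mul [ContinuousConstSMul L M] (he : IsC1ActionIn L e) {k l : L}
    {x : M} (hx : x ∈ e.source) (hlx : l • x ∈ e.source) (hklx : k • l • x ∈ e.source) :
    actDeriv e (k * l) x = (actDeriv e k (l • x)).comp (actDeriv e l x) := by
  have := hasFDerivAt_comp_charts (f := fun y => e (k • y)) (g := fun y => l • y) hx hlx
    (continuous_const_smul l).continuousAt (he.hasFDerivAt hlx hklx) (he.hasFDerivAt hx hlx)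
  simp only [smul_smul] at this
  exact this.fderiv

theorem actDeriv_one {x : M} (hx : x ∈ e.source) :
    actDeriv e (1 : L) x = ContinuousLinearMap.id ℝ F := by
  have h1 : (fun z => e ((1 : L) • e.symm z)) =ᶠ[𝓝 (e x)] id := by
    filter_upwards [e.open_target.mem_nhds (e.map_source hx)] with z hz
    simp [e.right_inv hz]
  rw [actDeriv, h1.fderiv_eq, fderiv_id]

theorem IsC1ActionIn.continuousAt_actDeriv_right (he : IsC1ActionIn L e) {l : L} {x : M}
    (hx : x ∈ e.source) (hlx : l • x ∈ e.source) : ContinuousAt (fun y => actDeriv e l y) x :=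
  ContinuousAt.comp (f := e) (((he l x hx hlx).fderiv_right le_rfl).continuousAt (n := 0))
    (e.continuousAt hx)

variable [TopologicalSpace L] [IsTopologicalGroup L] [CompactSpace L] [T2Space L] [ContinuousSMul L M]

omit [NormedSpace ℝ F] [T2Space L] [IsTopologicalGroup L] [CompactSpace L] in
theorem continuousAt_chart_smul {l : L} {u : F} (hu : u ∈ e.target)
    (hlu : l • e.symm u ∈ e.source) :
    ContinuousAt (fun p : L × F => e (p.1 • e.symm p.2)) (l, u) := by
  have h1 : ContinuousAt (fun p : L × F => p.1 • e.symm p.2) (l, u) :=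
    continuousAt_fst.smul (ContinuousAt.comp (g := e.symm) (f := Prod.snd)
      (e.continuousAt_symm hu) continuousAt_snd)
  exact ContinuousAt.comp (g := e) (f := fun p : L × F => p.1 • e.symm p.2)
    (e.continuousAt hlu) h1

/-- The oscillation of the derivatives in a direction `h` is arbitrarily small somewhere in each
open set of transformations: by Baire's theorem, the difference quotients of the transformations
converge uniformly, up to `ε`, for the transformations in a nonempty open set. -/
theorem IsC1ActionIn.exists_oscillation_le (he : IsC1ActionIn L e) {x₀ : M} (hx₀ : x₀ ∈ e.source)
    (h : F) {ε : ℝ} (hε : 0 < ε) {O : Set L} (hO : IsOpen O) {l₁ : L} (hl₁ : l₁ ∈ O)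
    (hl₁x : l₁ • x₀ ∈ e.source) :
    ∃ l₂ ∈ O, ∃ q : F, ∀ᶠ p : L × M in 𝓝 (l₂, x₀), dist (actDeriv e p.1 p.2 h) q ≤ 2 * ε := by
  set u₀ := e x₀ with hu₀
  have hu₀T : u₀ ∈ e.target := e.map_source hx₀
  set f : L → F → F := fun l u => e (l • e.symm u) with hf
  have hev : ∀ᶠ p : L × F in 𝓝 (l₁, u₀), p.1 ∈ O ∧ p.2 ∈ e.target ∧ p.1 • e.symm p.2 ∈ e.source := by
    have h1 : ContinuousAt (fun p : L × F => p.1 • e.symm p.2) (l₁, u₀) :=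
      continuousAt_fst.smul (ContinuousAt.comp (g := e.symm) (f := Prod.snd)
        (e.continuousAt_symm hu₀T) continuousAt_snd)
    refine (continuousAt_fst.eventually (hO.mem_nhds hl₁)).and
      ((continuousAt_snd.eventually (e.open_target.mem_nhds hu₀T)).and
        (h1.eventually (e.open_source.mem_nhds ?_)))
    simpa [hu₀, e.left_inv hx₀] using hl₁x
  obtain ⟨A, hA, B, hB, hAB⟩ := mem_nhds_prod_iff.1 hev
  obtain ⟨O', hO', hO'cl, hO'A⟩ := exists_mem_nhds_isClosed_subset hA
  obtain ⟨r, hr, hrB⟩ := Metric.mem_nhds_iff.1 hB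
  have hdom : ∀ l ∈ O', ∀ u ∈ Metric.ball u₀ r,
      l ∈ O ∧ u ∈ e.target ∧ l • e.symm u ∈ e.source := fun l hl u hu =>
    hAB (mk_mem_prod (hO'A hl) (hrB hu))
  set ρ : ℕ → ℝ := fun k => r / (2 * (1 + ‖h‖)) / ((k : ℝ) + 1) with hρ
  have hρ0 : ∀ k, 0 < ρ k := fun k => by positivity
  have hρr : ∀ k, ρ k * (1 + ‖h‖) < r := by
    intro k
    have h1 : ρ k ≤ r / (2 * (1 + ‖h‖)) := div_le_self (by positivity) (by simp)
    have h2 : r / (2 * (1 + ‖h‖)) * (1 + ‖h‖) = r / 2 := by field_simp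
    nlinarith [norm_nonneg h]
  have hstep : ∀ {s : ℝ} {v : F} {t : ℝ}, v ∈ Metric.closedBall u₀ s → t ∈ Icc 0 s →
      v + t • h ∈ Metric.closedBall u₀ (s * (1 + ‖h‖)) := by
    intro s v t hv ht
    rw [mem_closedBall_iff_norm] at hv ⊢
    calc ‖v + t • h - u₀‖ = ‖(v - u₀) + t • h‖ := by congr 1; abel
      _ ≤ ‖v - u₀‖ + ‖t • h‖ := norm_add_le _ _
      _ ≤ s + s * ‖h‖ := by
        rw [norm_smul, Real.norm_eq_abs, abs_of_nonneg ht.1]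
        gcongr
        exact ht.2
      _ = s * (1 + ‖h‖) := by ring
  have hmem : ∀ k, ∀ v ∈ Metric.closedBall u₀ (ρ k), v ∈ Metric.ball u₀ r := by
    intro k v hv
    refine Metric.closedBall_subset_ball ?_ hv
    nlinarith [hρr k, hρ0 k, norm_nonneg h]
  have hmem' : ∀ k, ∀ v ∈ Metric.closedBall u₀ (ρ k), ∀ t ∈ Icc 0 (ρ k),
      v + t • h ∈ Metric.ball u₀ r := fun k v hv t ht =>
    Metric.closedBall_subset_ball (hρr k) (hstep hv ht)
  set Q : L → F → ℝ → F := fun l v t => t⁻¹ • (f l (v + t • h) - f l v) with hQ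
  have hfc : ∀ u ∈ Metric.ball u₀ r, ∀ l ∈ O', ContinuousAt (fun l => f l u) l := by
    intro u hu l hl
    have h1 := hdom l hl u hu
    exact ContinuousAt.comp (f := fun l : L => (l, u)) (continuousAt_chart_smul h1.2.1 h1.2.2)
      (by fun_prop)
  have hQc : ∀ k, ∀ v ∈ Metric.closedBall u₀ (ρ k), ∀ t ∈ Icc 0 (ρ k), ∀ l ∈ O',
      ContinuousAt (fun l => Q l v t) l := fun k v hv t ht l hl =>
    ((hfc _ (hmem' k v hv t ht) l hl).sub (hfc _ (hmem k v hv) l hl)).const_smul _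
  have hu₀mem : ∀ k, u₀ ∈ Metric.closedBall u₀ (ρ k) := fun k =>
    Metric.mem_closedBall_self (hρ0 k).le
  have hρmem : ∀ k, ρ k ∈ Icc 0 (ρ k) := fun k => right_mem_Icc.2 (hρ0 k).le
  -- the transformations whose difference quotients at scales up to `ρ k` agree up to `ε`
  set C : ℕ → Set L := fun k => O' ∩ ⋂ v ∈ Metric.closedBall u₀ (ρ k), ⋂ t ∈ Ioc 0 (ρ k),
    O' ∩ {l | ‖Q l v t - Q l u₀ (ρ k)‖ ≤ ε} with hC
  have hCcl : ∀ k, IsClosed (C k) := by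
    intro k
    refine hO'cl.inter (isClosed_biInter fun v hv => isClosed_biInter fun t ht => ?_)
    have h1 : ContinuousOn (fun l => ‖Q l v t - Q l u₀ (ρ k)‖) O' := fun l hl =>
      ((hQc k v hv t (Ioc_subset_Icc_self ht) l hl).sub
        (hQc k u₀ (hu₀mem k) _ (hρmem k) l hl)).norm.continuousWithinAt
    exact h1.preimage_isClosed_of_isClosed hO'cl isClosed_Iic
  have hCun : ∀ l ∈ O', ∃ k, l ∈ C k := by
    intro l hl
    have h0 := hdom l hl u₀ (Metric.mem_ball_self hr)
    have hstrict : HasStrictFDerivAt (f l) (actDeriv e l x₀) u₀ := by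
      refine ContDiffAt.hasStrictFDerivAt (he l x₀ hx₀ ?_) one_ne_zero
      simpa [hu₀, e.left_inv hx₀] using h0.2.2
    set D := actDeriv e l x₀ with hD
    set η := ε / (2 * (1 + ‖h‖)) with hη
    have hη0 : 0 < η := by positivity
    have hlit := (Asymptotics.isLittleO_iff.1 hstrict.isLittleO) hη0
    rw [nhds_prod_eq] at hlit
    obtain ⟨δ, hδ, hδs⟩ := (Metric.nhds_basis_ball.prod_self.eventually_iff).1 hlit
    obtain ⟨k, hk⟩ : ∃ k, ρ k * (1 + ‖h‖) < δ := by
      obtain ⟨k, hk⟩ := exists_nat_gt (r / 2 / δ)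
      refine ⟨k, ?_⟩
      rw [div_lt_iff₀ hδ] at hk
      have h2 : ρ k * (1 + ‖h‖) = r / 2 / ((k : ℝ) + 1) := by
        simp only [hρ]; field_simp
      rw [h2, div_lt_iff₀ (by positivity)]
      nlinarith
    have hq : ∀ v ∈ Metric.closedBall u₀ (ρ k), ∀ t ∈ Ioc 0 (ρ k), ‖Q l v t - D h‖ ≤ ε / 2 := by
      intro v hv t ht
      have h1 := Metric.closedBall_subset_ball hk (hstep hv (Ioc_subset_Icc_self ht))
      have h2 : v ∈ Metric.ball u₀ δ := by
        have := Metric.closedBall_subset_ball hk (hstep hv (left_mem_Icc.2 (hρ0 k).le))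
        simpa using this
      have h3 := hδs (mk_mem_prod h1 h2)
      simp only [add_sub_cancel_left, map_smul] at h3
      have h4 : Q l v t - D h = t⁻¹ • (f l (v + t • h) - f l v - t • D h) := by
        rw [smul_sub, inv_smul_smul₀ ht.1.ne']
      rw [h4, norm_smul, norm_inv, Real.norm_eq_abs, abs_of_pos ht.1, inv_mul_le_iff₀ ht.1]
      refine h3.trans ?_
      rw [norm_smul, Real.norm_eq_abs, abs_of_pos ht.1, hη]
      have h5 : ε / (2 * (1 + ‖h‖)) * (t * ‖h‖) ≤ ε / (2 * (1 + ‖h‖)) * (t * (1 + ‖h‖)) := by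
        gcongr
        · exact ht.1.le
        · linarith
      refine h5.trans (le_of_eq ?_)
      field_simp
    refine ⟨k, hl, mem_iInter₂.2 fun v hv => mem_iInter₂.2 fun t ht => ⟨hl, ?_⟩⟩
    have h1 := hq v hv t ht
    have h2 := hq u₀ (hu₀mem k) (ρ k) (right_mem_Ioc.2 (hρ0 k))
    calc ‖Q l v t - Q l u₀ (ρ k)‖ = ‖(Q l v t - D h) - (Q l u₀ (ρ k) - D h)‖ := by congr 1; abel
      _ ≤ ‖Q l v t - D h‖ + ‖Q l u₀ (ρ k) - D h‖ := norm_sub_le _ _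
      _ ≤ ε := by linarith
  -- the sets `C k` cover only `O'`, so the closed complement of its interior joins the family
  let g : Option ℕ → Set L := fun i => i.elim (interior O')ᶜ C
  have hdense : Dense (⋃ i, interior (g i)) := by
    refine dense_iUnion_interior_of_closed ?_ ?_
    · rintro (_ | k)
      · exact isOpen_interior.isClosed_compl
      · exact hCcl k
    · refine eq_univ_of_forall fun l => ?_
      by_cases hl : l ∈ interior O'
      · obtain ⟨k, hk⟩ := hCun l (interior_subset hl)
        exact mem_iUnion.2 ⟨some k, hk⟩
      · exact mem_iUnion.2 ⟨none, hl⟩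
  obtain ⟨l₂, hl₂O, hl₂⟩ := hdense.inter_open_nonempty _ isOpen_interior
    ⟨l₁, mem_interior_iff_mem_nhds.2 hO'⟩
  obtain ⟨i, hi⟩ := mem_iUnion.1 hl₂
  rcases i with _ | k
  · exact absurd hl₂O (interior_subset hi)
  have hl₂O' := interior_subset hl₂O
  refine ⟨l₂, (hdom l₂ hl₂O' u₀ (Metric.mem_ball_self hr)).1, Q l₂ u₀ (ρ k), ?_⟩
  have e1 : ∀ᶠ l in 𝓝 l₂, l ∈ C k := mem_interior_iff_mem_nhds.1 hi
  have e2 : ∀ᶠ l in 𝓝 l₂, dist (Q l u₀ (ρ k)) (Q l₂ u₀ (ρ k)) < ε :=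
    (hQc k u₀ (hu₀mem k) _ (hρmem k) l₂ hl₂O').eventually (Metric.ball_mem_nhds _ hε)
  have e3 : ∀ᶠ x in 𝓝 x₀, x ∈ e.source ∧ e x ∈ Metric.closedBall u₀ (ρ k) :=
    (e.open_source.eventually_mem hx₀).and
      ((e.continuousAt hx₀).eventually (Metric.closedBall_mem_nhds _ (hρ0 k)))
  have e4 := (e1.and e2).prod_mk e3
  rw [← nhds_prod_eq] at e4
  filter_upwards [e4] with p ⟨⟨hp1, hp2⟩, hp3, hp4⟩
  have hd := hdom p.1 hp1.1 _ (hmem k _ hp4)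
  rw [e.left_inv hp3] at hd
  have hlim : Tendsto (fun t => Q p.1 (e p.2) t) (𝓝[>] 0) (𝓝 (actDeriv e p.1 p.2 h)) :=
    ((he.hasFDerivAt hp3 hd.2.2).hasLineDerivAt h).tendsto_slope_zero_right
  have hle : dist (actDeriv e p.1 p.2 h) (Q p.1 u₀ (ρ k)) ≤ ε := by
    refine le_of_tendsto (hlim.dist tendsto_const_nhds) ?_
    filter_upwards [Ioc_mem_nhdsGT (hρ0 k)] with t ht
    rw [dist_eq_norm]
    exact (mem_iInter₂.1 (mem_iInter₂.1 hp1.2 _ hp4) t ht).2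
  linarith [dist_triangle (actDeriv e p.1 p.2 h) (Q p.1 u₀ (ρ k)) (Q l₂ u₀ (ρ k))]

/-- Given `x₀`, the derivatives in a direction `h` are jointly continuous at some `(l₀, x₀)`. -/
theorem IsC1ActionIn.exists_continuousAt_actDeriv (he : IsC1ActionIn L e) {x₀ : M}
    (hx₀ : x₀ ∈ e.source) (h : F) {l₁ : L} (hl₁x : l₁ • x₀ ∈ e.source) :
    ∃ l₀ : L, l₀ • x₀ ∈ e.source ∧
      ContinuousAt (fun p : L × M => actDeriv e p.1 p.2 h) (l₀, x₀) := by
  set S : Set L := {l | l • x₀ ∈ e.source} with hS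
  have hSo : IsOpen S := e.open_source.preimage (by fun_prop)
  set G : ℕ → Set L := fun n => {l | ∃ q : F, ∀ᶠ p : L × M in 𝓝 (l, x₀),
    dist (actDeriv e p.1 p.2 h) q ≤ 2 * (1 / ((n : ℝ) + 1))} with hG
  have hGo : ∀ n, IsOpen (G n) := by
    intro n
    simp only [hG, Set.ofPred_exists]
    refine isOpen_iUnion fun q => ?_
    exact (isOpen_setOfPred_eventually_nhds (p := fun p : L × M =>
      dist (actDeriv e p.1 p.2 h) q ≤ 2 * (1 / ((n : ℝ) + 1)))).preimage
        (Continuous.prodMk_left x₀)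
  -- the complement of `closure S` is added because `G n` is only known to be dense in `S`
  have hdense : Dense (⋂ n, G n ∪ (closure S)ᶜ) := by
    refine dense_iInter_of_isOpen_nat (fun n => (hGo n).union isClosed_closure.isOpen_compl)
      fun n => dense_iff_inter_open.2 fun O hO ⟨l, hl⟩ => ?_
    by_cases hOS : (O ∩ S).Nonempty
    · obtain ⟨l₂, hl₂, hl₂S⟩ := hOS
      obtain ⟨l₃, hl₃, q, hq⟩ := he.exists_oscillation_le hx₀ h
        (show (0 : ℝ) < 1 / ((n : ℝ) + 1) by positivity) hO hl₂ hl₂S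
      exact ⟨l₃, hl₃, Or.inl ⟨q, hq⟩⟩
    · refine ⟨l, hl, Or.inr fun hcl => hOS ?_⟩
      exact mem_closure_iff.1 hcl O hO hl
  obtain ⟨l₀, hl₀S, hl₀⟩ := hdense.inter_open_nonempty S hSo ⟨l₁, hl₁x⟩
  refine ⟨l₀, hl₀S, Metric.tendsto_nhds.2 fun ε hε => ?_⟩
  obtain ⟨n, hn⟩ := exists_nat_gt (4 / ε)
  rcases mem_iInter.1 hl₀ n with hq | hq
  · obtain ⟨q, hq⟩ := hq
    have h0 := hq.self_of_nhds
    filter_upwards [hq] with p hp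
    have h1 := dist_triangle_right (actDeriv e p.1 p.2 h) (actDeriv e l₀ x₀ h) q
    have h2 : 4 * (1 / ((n : ℝ) + 1)) < ε := by
      rw [div_lt_iff₀ hε] at hn
      rw [mul_one_div, div_lt_iff₀ (by positivity)]
      nlinarith
    linarith
  · exact absurd (subset_closure hl₀S) hq

/-- A continuous action of a compact group by `C^1` transformations has jointly continuous
derivatives (Bochner–Montgomery). Continuity at one point of `L × {x₀}`, which Baire's theorem
provides, spreads to the others by the chain rule. -/
theorem IsC1ActionIn.continuousAt_actDeriv [FiniteDimensional ℝ F] (he : IsC1ActionIn L e) {l : L}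
    {x : M} (hx : x ∈ e.source) (hlx : l • x ∈ e.source) :
    ContinuousAt (fun p : L × M => actDeriv e p.1 p.2) (l, x) := by
  have hΩ : IsOpen {p : L × M | p.2 ∈ e.source ∧ p.1 • p.2 ∈ e.source} :=
    (e.open_source.preimage continuous_snd).inter (e.open_source.preimage continuous_smul)
  suffices h : ContinuousOn (fun p : L × M => actDeriv e p.1 p.2)
      {p : L × M | p.2 ∈ e.source ∧ p.1 • p.2 ∈ e.source} from
    h.continuousAt (hΩ.mem_nhds ⟨hx, hlx⟩)
  rw [continuousOn_clm_apply]
  rintro h ⟨l, x⟩ ⟨hx, hlx⟩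
  dsimp only at hx hlx
  obtain ⟨l₀, hl₀, hcont⟩ := he.exists_continuousAt_actDeriv hx h hlx
  refine ContinuousAt.continuousWithinAt ?_
  -- near `(l, x)` the transformations factor through `k`, which is fixed, and some near `l₀`
  set k := l * l₀⁻¹ with hk
  have hkl : k⁻¹ * l = l₀ := by simp [hk]
  have hkl₀ : k • l₀ • x = l • x := by simp [hk, smul_smul]
  have hmap : ContinuousAt (fun p : L × M => (k⁻¹ * p.1, p.2)) (l, x) := by fun_prop
  have h1 : ContinuousAt (fun p : L × M => actDeriv e (k⁻¹ * p.1) p.2 h) (l, x) := by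
    refine ContinuousAt.comp (f := fun p : L × M => (k⁻¹ * p.1, p.2))
      (g := fun p : L × M => actDeriv e p.1 p.2 h) ?_ hmap
    simpa only [hkl] using hcont
  have hsm : ContinuousAt (fun p : L × M => (k⁻¹ * p.1) • p.2) (l, x) := by fun_prop
  have h2 : ContinuousAt (fun p : L × M => actDeriv e k ((k⁻¹ * p.1) • p.2)) (l, x) := by
    refine ContinuousAt.comp (f := fun p : L × M => (k⁻¹ * p.1) • p.2)
      (g := fun y => actDeriv e k y) ?_ hsm
    simp only [hkl]
    exact he.continuousAt_actDeriv_right hl₀ (by rwa [hkl₀])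
  refine (h2.clm_apply h1).congr ?_
  have hsrc : ∀ᶠ p : L × M in 𝓝 (l, x), (k⁻¹ * p.1) • p.2 ∈ e.source :=
    hsm.eventually (e.open_source.mem_nhds (by simpa only [hkl] using hl₀))
  filter_upwards [hΩ.mem_nhds ⟨hx, hlx⟩, hsrc] with p hp hp'
  have h3 := he.actDeriv_mul (k := k) (l := k⁻¹ * p.1) hp.1 hp'
    (by simpa [smul_smul] using hp.2)
  rw [mul_inv_cancel_left] at h3
  rw [h3]
  rfl

end Action

open MeasureTheory

/-! ### Averaging over the group -/

/-- What holds near the stabilizer of `x₀` holds for all transformations which bring some point near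
`x₀` back near `x₀`. -/
theorem exists_nhds_forall_smul_mem {M L : Type*} [TopologicalSpace M] [T2Space M] [Group L]
    [TopologicalSpace L] [CompactSpace L] [MulAction L M] [ContinuousSMul L M] {x₀ : M}
    {P : L → M → M → Prop}
    (hP : ∀ l : L, l • x₀ = x₀ → ∀ᶠ p : L × M × M in 𝓝 (l, x₀, x₀), P p.1 p.2.1 p.2.2) :
    ∃ B ∈ 𝓝 x₀, ∀ l : L, ∀ x ∈ B, ∀ y ∈ B, l • x ∈ B → P l x y := by
  -- the third variable `w` stands for `l • x`; if `l` moves `x₀`, then `l • x ≠ w` near `x₀`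
  have key : ∀ᶠ z : M × M × M in 𝓝 (x₀, x₀, x₀), ∀ l ∈ (univ : Set L),
      l • z.1 = z.2.2 → P l z.1 z.2.1 := by
    refine isCompact_univ.eventually_forall_of_forall_eventually
      (P := fun (z : M × M × M) (l : L) => l • z.1 = z.2.2 → P l z.1 z.2.1) fun l _ => ?_
    by_cases hl : l • x₀ = x₀
    · have h1 : Tendsto (fun q : (M × M × M) × L => (q.2, q.1.1, q.1.2.1))
          (𝓝 ((x₀, x₀, x₀), l)) (𝓝 (l, x₀, x₀)) :=
        Continuous.tendsto' (by fun_prop) _ _ rfl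
      filter_upwards [h1.eventually (hP l hl)] with q hq _ using hq
    · have h1 : ContinuousAt (fun q : (M × M × M) × L => q.2 • q.1.1) ((x₀, x₀, x₀), l) := by
        fun_prop
      have h2 : ContinuousAt (fun q : (M × M × M) × L => q.1.2.2) ((x₀, x₀, x₀), l) := by
        fun_prop
      filter_upwards [(h1.prodMk h2).eventually
        ((isClosed_diagonal.isOpen_compl).mem_nhds (show (l • x₀, x₀) ∈ (diagonal M)ᶜ from hl))]
        with q hq hq' using absurd hq' hq
  obtain ⟨A, hA, A', hA', hAA⟩ := mem_nhds_prod_iff.1 key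
  obtain ⟨B, hB, C, hC, hBC⟩ := mem_nhds_prod_iff.1 hA'
  refine ⟨A ∩ (B ∩ C), inter_mem hA (inter_mem hB hC), fun l x hx y hy hlx => ?_⟩
  exact hAA (mk_mem_prod hx.1 (hBC (mk_mem_prod hy.2.1 hlx.2.2))) l (mem_univ l) rfl

section Averaging

variable {F : Type*} [NormedAddCommGroup F] [NormedSpace ℝ F]
  {M : Type*} [TopologicalSpace M]

/-- The closed ball of radius `r` about `x₀` in the chart `e`. -/
def chartBall (e : OpenPartialHomeomorph M F) (x₀ : M) (r : ℝ) : Set M :=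
  e.source ∩ e ⁻¹' Metric.closedBall (e x₀) r

section ChartBall

variable {e : OpenPartialHomeomorph M F} {x₀ : M} {r : ℝ}

omit [NormedSpace ℝ F] in
theorem chartBall_mem_nhds (hx₀ : x₀ ∈ e.source) (hr : 0 < r) : chartBall e x₀ r ∈ 𝓝 x₀ :=
  inter_mem (e.open_source.mem_nhds hx₀)
    ((e.continuousAt hx₀).preimage_mem_nhds (Metric.closedBall_mem_nhds _ hr))

omit [NormedSpace ℝ F] in
theorem chartBall_mono {s : ℝ} (h : s ≤ r) : chartBall e x₀ s ⊆ chartBall e x₀ r := fun _ hx =>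
  ⟨hx.1, Metric.closedBall_subset_closedBall h hx.2⟩

omit [NormedSpace ℝ F] in
theorem symm_mem_chartBall (hT : Metric.closedBall (e x₀) r ⊆ e.target) {v : F}
    (hv : v ∈ Metric.closedBall (e x₀) r) : e.symm v ∈ chartBall e x₀ r :=
  ⟨e.map_target (hT hv), by rwa [mem_preimage, e.right_inv (hT hv)]⟩

theorem isClosed_chartBall [FiniteDimensional ℝ F] [T2Space M]
    (hT : Metric.closedBall (e x₀) r ⊆ e.target) : IsClosed (chartBall e x₀ r) := by
  have : ProperSpace F := FiniteDimensional.proper_real F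
  have h1 : chartBall e x₀ r = e.symm '' Metric.closedBall (e x₀) r := by
    ext x
    constructor
    · exact fun hx => ⟨e x, hx.2, e.left_inv hx.1⟩
    · rintro ⟨v, hv, rfl⟩
      exact symm_mem_chartBall hT hv
  rw [h1]
  exact ((isCompact_closedBall _ _).image_of_continuousOn (e.continuousOn_symm.mono hT)).isClosed

omit [NormedSpace ℝ F] in
theorem exists_chartBall_subset (hx₀ : x₀ ∈ e.source) {B : Set M} (hB : B ∈ 𝓝 x₀) :
    ∃ r > 0, Metric.closedBall (e x₀) r ⊆ e.target ∧ chartBall e x₀ r ⊆ B := by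
  have h1 : e.target ∩ e.symm ⁻¹' B ∈ 𝓝 (e x₀) :=
    inter_mem (e.open_target.mem_nhds (e.map_source hx₀)) ((e.tendsto_symm hx₀) hB)
  obtain ⟨r, hr, hrB⟩ := Metric.nhds_basis_closedBall.mem_iff.1 h1
  refine ⟨r, hr, fun v hv => (hrB hv).1, fun x hx => ?_⟩
  have := (hrB hx.2).2
  rwa [mem_preimage, e.left_inv hx.1] at this

/-- A continuous bump function supported on a ball of a chart. -/
theorem exists_chart_bump [FiniteDimensional ℝ F] [T2Space M]
    (hT : Metric.closedBall (e x₀) r ⊆ e.target) :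
    ∃ χ : M → ℝ, Continuous χ ∧ (∀ x, 0 ≤ χ x) ∧
      ∀ x, 0 < χ x ↔ x ∈ e.source ∧ dist (e x) (e x₀) < r := by
  classical
  refine ⟨fun x => if x ∈ e.source then max 0 (r - dist (e x) (e x₀)) else 0, ?_, ?_, ?_⟩
  · rw [continuous_iff_continuousAt]
    intro x
    by_cases hx : x ∈ e.source
    · have h1 : ContinuousAt (fun x => max 0 (r - dist (e x) (e x₀))) x := by
        have := e.continuousAt hx
        fun_prop
      refine h1.congr ?_
      filter_upwards [e.open_source.mem_nhds hx] with y hy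
      rw [if_pos hy]
    · refine (continuousAt_const (y := (0 : ℝ))).congr ?_
      filter_upwards [(isClosed_chartBall hT).isOpen_compl.mem_nhds
        (fun h : x ∈ chartBall e x₀ r => hx h.1)] with y hy
      split_ifs with hys
      · refine (max_eq_left ?_).symm
        by_contra! hcon
        exact hy ⟨hys, Metric.mem_closedBall.2 (by linarith)⟩
      · rfl
  · intro x
    dsimp only
    split_ifs <;> simp
  · intro x
    dsimp only
    split_ifs with hx <;> simp [hx]

end ChartBall

variable {L : Type*} [Group L] [MulAction L M]

/-- At the scale `r` about `x₀`, the transformations bringing points of the chart ball back into it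
have derivatives that vary by at most `ε`, and they stretch the direction `h` to length at most
`C`. -/
structure IsAveragingScale (L : Type*) [Group L] [MulAction L M] (e : OpenPartialHomeomorph M F)
    (x₀ : M) (h : F) (C ε r : ℝ) : Prop where
  closedBall_subset : Metric.closedBall (e x₀) r ⊆ e.target
  estimates : ∀ g : L, ∀ x ∈ chartBall e x₀ r, ∀ y ∈ chartBall e x₀ r,
    g • x ∈ chartBall e x₀ r → g • y ∈ e.source ∧
      ‖(actDeriv e g⁻¹ (g • x)).comp (actDeriv e g y) - ContinuousLinearMap.id ℝ F‖ ≤ ε ∧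
      ‖actDeriv e g⁻¹ (g • x) h‖ ≤ C

variable [TopologicalSpace L] [IsTopologicalGroup L] [CompactSpace L] [T2Space L]
  [ContinuousSMul L M] [MeasurableSpace L] [BorelSpace L]

/-- The average `∫ χ (g x) dg`. -/
noncomputable def orbitAverage (μ : Measure L) (χ : M → ℝ) (x : M) : ℝ := ∫ g, χ (g • x) ∂μ

/-- The average `∫ χ (g x) T_{g x} g⁻¹ (e (g y) - e (g x) - s h) dg ∈ T_x M`, where `y` is the point
with coordinates `v` in the chart `e`. The point `y` for which it vanishes is an equivariant
replacement for the point `x + s h`. -/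
noncomputable def averagedStep (μ : Measure L) (e : OpenPartialHomeomorph M F) (χ t : M → ℝ) (h : F)
    (x : M) (v : F) : F :=
  ∫ g, χ (g • x) • actDeriv e g⁻¹ (g • x) (e (g • e.symm v) - e (g • x) - t x • h) ∂μ

section OrbitAverage

variable {μ : Measure L} {χ : M → ℝ}

omit [IsTopologicalGroup L] [T2Space L] in
theorem continuous_orbitAverage [IsFiniteMeasure μ] (hχ : Continuous χ) :
    Continuous (orbitAverage μ χ) := by
  rw [← continuousOn_univ]
  exact continuousOn_integral_of_compact_support (k := univ) isCompact_univ
    (Continuous.continuousOn (by fun_prop)) (fun p x _ hx => absurd (mem_univ x) hx)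

omit [T2Space L] [TopologicalSpace M] [ContinuousSMul L M] [CompactSpace L] in
theorem orbitAverage_smul [μ.IsMulRightInvariant] (k : L) (x : M) :
    orbitAverage μ χ (k • x) = orbitAverage μ χ x := by
  simp only [orbitAverage, smul_smul]
  exact integral_mul_right_eq_self (fun g => χ (g • x)) k

omit [IsTopologicalGroup L] [T2Space L] in
theorem integrable_smul [IsFiniteMeasure μ] (hχ : Continuous χ) (x : M) :
    Integrable (fun g : L => χ (g • x)) μ :=
  Continuous.integrable_of_hasCompactSupport (by fun_prop) (HasCompactSupport.of_compactSpace _)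

omit [IsTopologicalGroup L] [T2Space L] in
theorem orbitAverage_pos [IsFiniteMeasure μ] [μ.IsOpenPosMeasure] (hχ : Continuous χ)
    (hχ0 : ∀ x, 0 ≤ χ x) {x : M} (hx : 0 < χ x) : 0 < orbitAverage μ χ x := by
  refine Continuous.integral_pos_of_hasCompactSupport_nonneg_nonzero (x := (1 : L)) (by fun_prop)
    (HasCompactSupport.of_compactSpace _) (fun g => hχ0 _) ?_
  simpa using hx.ne'

end OrbitAverage

end Averaging

/-! ### The averaged equation -/

section AveragedStep

variable {F : Type*} [NormedAddCommGroup F] [NormedSpace ℝ F] [FiniteDimensional ℝ F]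
  {M : Type*} [TopologicalSpace M] [T2Space M]
  {L : Type*} [Group L] [MulAction L M]
  [TopologicalSpace L] [IsTopologicalGroup L] [CompactSpace L] [T2Space L]
  [ContinuousSMul L M] [MeasurableSpace L] [BorelSpace L]
  {μ : Measure L} [IsFiniteMeasure μ] {e : OpenPartialHomeomorph M F} {χ t : M → ℝ} {h : F}
  {x₀ : M} {C ε r : ℝ}

omit [MeasurableSpace L] [BorelSpace L] in
theorem IsAveragingScale.continuousOn_integrand (hr : IsAveragingScale L e x₀ h C ε r)
    (he : IsC1ActionIn L e) (hχ : Continuous χ) (hχr : ∀ x, χ x ≠ 0 → x ∈ chartBall e x₀ r)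
    (ht : Continuous t) {v : F} (hv : v ∈ Metric.closedBall (e x₀) r) :
    ContinuousOn (Function.uncurry fun (x : M) (g : L) =>
      χ (g • x) • actDeriv e g⁻¹ (g • x) (e (g • e.symm v) - e (g • x) - t x • h))
      (chartBall e x₀ r ×ˢ univ) := by
  rintro ⟨x, g⟩ ⟨hx, -⟩
  refine ContinuousAt.continuousWithinAt ?_
  have hsm : ContinuousAt (fun p : M × L => p.2 • p.1) (x, g) := by fun_prop
  by_cases hgx : g • x ∈ chartBall e x₀ r
  · have hgv := (hr.estimates g x hx (e.symm v) (symm_mem_chartBall hr.closedBall_subset hv) hgx).1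
    have h1 : ContinuousAt (fun p : M × L => actDeriv e p.2⁻¹ (p.2 • p.1)) (x, g) := by
      refine ContinuousAt.comp (f := fun p : M × L => (p.2⁻¹, p.2 • p.1))
        (g := fun p : L × M => actDeriv e p.1 p.2) ?_ (by fun_prop)
      exact he.continuousAt_actDeriv hgx.1 (by simpa using hx.1)
    have h2 : ContinuousAt (fun p : M × L => e (p.2 • e.symm v)) (x, g) :=
      ContinuousAt.comp (f := fun p : M × L => p.2 • e.symm v) (g := e)
        (e.continuousAt hgv) (by fun_prop)
    have h3 : ContinuousAt (fun p : M × L => e (p.2 • p.1)) (x, g) :=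
      ContinuousAt.comp (f := fun p : M × L => p.2 • p.1) (g := e) (e.continuousAt hgx.1) hsm
    have h4 : ContinuousAt (fun p : M × L => t p.1 • h) (x, g) := by fun_prop
    have h5 : ContinuousAt (fun p : M × L => χ (p.2 • p.1)) (x, g) := by fun_prop
    exact h5.smul (h1.clm_apply ((h2.sub h3).sub h4))
  · refine (continuousAt_const (y := (0 : F))).congr ?_
    filter_upwards [hsm.eventually ((isClosed_chartBall hr.closedBall_subset).isOpen_compl.mem_nhds
      hgx)] with p hp
    have : χ (p.2 • p.1) = 0 := by
      by_contra h0
      exact hp (hχr _ h0)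
    simp [Function.uncurry, this]

theorem IsAveragingScale.continuousOn_averagedStep (hr : IsAveragingScale L e x₀ h C ε r)
    (he : IsC1ActionIn L e) (hχ : Continuous χ) (hχr : ∀ x, χ x ≠ 0 → x ∈ chartBall e x₀ r)
    (ht : Continuous t) {v : F} (hv : v ∈ Metric.closedBall (e x₀) r) :
    ContinuousOn (fun x => averagedStep μ e χ t h x v) (chartBall e x₀ r) :=
  continuousOn_integral_of_compact_support (k := univ) isCompact_univ
    (hr.continuousOn_integrand he hχ hχr ht hv) (fun _ _ _ hx => absurd (mem_univ _) hx)

theorem IsAveragingScale.integrable (hr : IsAveragingScale L e x₀ h C ε r)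
    (he : IsC1ActionIn L e) (hχ : Continuous χ) (hχr : ∀ x, χ x ≠ 0 → x ∈ chartBall e x₀ r)
    (ht : Continuous t) {v : F} (hv : v ∈ Metric.closedBall (e x₀) r) {x : M}
    (hx : x ∈ chartBall e x₀ r) :
    Integrable (fun g : L => χ (g • x) • actDeriv e g⁻¹ (g • x)
      (e (g • e.symm v) - e (g • x) - t x • h)) μ := by
  refine Continuous.integrable_of_hasCompactSupport ?_ (HasCompactSupport.of_compactSpace _)
  rw [← continuousOn_univ]
  exact (hr.continuousOn_integrand he hχ hχr ht hv).comp (f := fun g : L => (x, g))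
    (by fun_prop) fun g _ => ⟨hx, mem_univ g⟩

/-- As a function of `v`, the averaged step is close to a multiple of the identity. -/
theorem IsAveragingScale.norm_averagedStep_sub_le (hr : IsAveragingScale L e x₀ h C ε r)
    (he : IsC1ActionIn L e) (hχ : Continuous χ) (hχ0 : ∀ x, 0 ≤ χ x)
    (hχr : ∀ x, χ x ≠ 0 → x ∈ chartBall e x₀ r)
    (ht : Continuous t) {x : M} (hx : x ∈ chartBall e x₀ r) {v w : F}
    (hv : v ∈ Metric.closedBall (e x₀) r) (hw : w ∈ Metric.closedBall (e x₀) r) :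
    ‖averagedStep μ e χ t h x v - averagedStep μ e χ t h x w - orbitAverage μ χ x • (v - w)‖ ≤
      orbitAverage μ χ x * (ε * ‖v - w‖) := by
  have hi := integrable_smul (μ := μ) hχ x
  have hv' := hr.integrable (μ := μ) he hχ hχr ht hv hx
  have hw' := hr.integrable (μ := μ) he hχ hχr ht hw hx
  rw [averagedStep, averagedStep, orbitAverage, ← integral_sub hv' hw', ← integral_smul_const,
    ← integral_sub (by exact hv'.sub hw') (hi.smul_const _), ← integral_mul_const]
  refine norm_integral_le_of_norm_le (hi.mul_const _) (Eventually.of_forall fun g => ?_)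
  by_cases h0 : χ (g • x) = 0
  · simp [h0]
  have hgx := hχr _ h0
  set B := actDeriv e g⁻¹ (g • x) with hB
  have hlip := (convex_closedBall (e x₀) r).norm_image_sub_le_of_norm_hasFDerivWithin_le
    (f := fun z => B (e (g • e.symm z)) - z) (C := ε)
    (f' := fun z => B.comp (actDeriv e g (e.symm z)) - ContinuousLinearMap.id ℝ F)
    (fun z hz => by
      have hz' := symm_mem_chartBall hr.closedBall_subset hz
      have h1 := he.hasFDerivAt hz'.1 (hr.estimates g x hx _ hz' hgx).1
      rw [e.right_inv (hr.closedBall_subset hz)] at h1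
      exact ((B.hasFDerivAt.comp z h1).sub (hasFDerivAt_id z)).hasFDerivWithinAt)
    (fun z hz => (hr.estimates g x hx _ (symm_mem_chartBall hr.closedBall_subset hz) hgx).2.1)
    hw hv
  have hrw : χ (g • x) • B (e (g • e.symm v) - e (g • x) - t x • h) -
      χ (g • x) • B (e (g • e.symm w) - e (g • x) - t x • h) - χ (g • x) • (v - w) =
      χ (g • x) • (B (e (g • e.symm v)) - v - (B (e (g • e.symm w)) - w)) := by
    simp only [map_sub, smul_sub]
    abel
  rw [hrw, norm_smul, Real.norm_eq_abs, abs_of_nonneg (hχ0 _)]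
  exact mul_le_mul_of_nonneg_left hlip (hχ0 _)

omit [T2Space M] [IsTopologicalGroup L] [T2Space L] [FiniteDimensional ℝ F] in
theorem IsAveragingScale.norm_averagedStep_self_le (hr : IsAveragingScale L e x₀ h C ε r)
    (hχ : Continuous χ) (hχ0 : ∀ x, 0 ≤ χ x) (hχr : ∀ x, χ x ≠ 0 → x ∈ chartBall e x₀ r)
    {x : M} (htx : 0 ≤ t x) (hx : x ∈ chartBall e x₀ r) :
    ‖averagedStep μ e χ t h x (e x)‖ ≤ orbitAverage μ χ x * (t x * C) := by
  have hi := integrable_smul (μ := μ) hχ x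
  rw [averagedStep, orbitAverage, ← integral_mul_const]
  refine norm_integral_le_of_norm_le (hi.mul_const _) (Eventually.of_forall fun g => ?_)
  by_cases h0 : χ (g • x) = 0
  · simp [h0]
  rw [e.left_inv hx.1, sub_self, zero_sub, map_neg, map_smul, norm_smul, norm_neg, norm_smul,
    Real.norm_eq_abs, Real.norm_eq_abs, abs_of_nonneg (hχ0 _), abs_of_nonneg htx]
  have := (hr.estimates g x hx x hx (hχr _ h0)).2.2
  gcongr
  exact hχ0 _

/-- The averaged step is equivariant. -/
theorem IsAveragingScale.averagedStep_smul [μ.IsMulRightInvariant]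
    (hr : IsAveragingScale L e x₀ h C ε r)
    (he : IsC1ActionIn L e) (hχ : Continuous χ)
    (hχr : ∀ x, χ x ≠ 0 → x ∈ chartBall e x₀ r)
    (ht : Continuous t) (htinv : ∀ (l : L) x, t (l • x) = t x) {k : L} {x y : M}
    (hx : x ∈ chartBall e x₀ r) (hkx : k • x ∈ chartBall e x₀ r) (hy : y ∈ chartBall e x₀ r)
    (hky : k • y ∈ chartBall e x₀ r) :
    averagedStep μ e χ t h (k • x) (e (k • y)) =
      actDeriv e k x (averagedStep μ e χ t h x (e y)) := by
  have hint := hr.integrable (μ := μ) he hχ hχr ht hy.2 hx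
  rw [averagedStep, averagedStep, ← ContinuousLinearMap.integral_comp_comm _ hint,
    ← integral_mul_right_eq_self _ k⁻¹]
  refine integral_congr_ae (Eventually.of_forall fun g => ?_)
  simp only
  rw [e.left_inv hky.1, e.left_inv hy.1, htinv]
  simp only [smul_smul, inv_mul_cancel_right, map_smul, mul_inv_rev, inv_inv]
  by_cases h0 : χ (g • x) = 0
  · simp [h0]
  have hgx := hχr _ h0
  rw [he.actDeriv_mul hgx.1 (by simpa using hx.1) (by simpa using hkx.1), inv_smul_smul]
  rfl

/-- The averaged step vanishes at a unique point near `x`. -/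
theorem IsAveragingScale.eq_of_averagedStep_eq_zero (hr : IsAveragingScale L e x₀ h C ε r)
    (he : IsC1ActionIn L e) (hχ : Continuous χ) (hχ0 : ∀ x, 0 ≤ χ x)
    (hχr : ∀ x, χ x ≠ 0 → x ∈ chartBall e x₀ r) (hε : ε < 1)
    (ht : Continuous t) {x : M} (hx : x ∈ chartBall e x₀ r) (hmx : 0 < orbitAverage μ χ x)
    {v w : F} (hv : v ∈ Metric.closedBall (e x₀) r) (hw : w ∈ Metric.closedBall (e x₀) r)
    (hv0 : averagedStep μ e χ t h x v = 0) (hw0 : averagedStep μ e χ t h x w = 0) : v = w := by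
  have h1 := hr.norm_averagedStep_sub_le (μ := μ) he hχ hχ0 hχr ht hx hv hw
  rw [hv0, hw0, sub_zero, zero_sub, norm_neg, norm_smul, Real.norm_eq_abs, abs_of_pos hmx] at h1
  have h2 := le_of_mul_le_mul_left h1 hmx
  have h3 : ‖v - w‖ ≤ 0 := by nlinarith [norm_nonneg (v - w)]
  exact sub_eq_zero.1 (norm_le_zero_iff.1 h3)

/-- For small steps, the averaged step vanishes somewhere, by the contraction principle. -/
theorem IsAveragingScale.exists_averagedStep_eq_zero (hr : IsAveragingScale L e x₀ h C ε r)
    (he : IsC1ActionIn L e) (hχ : Continuous χ) (hχ0 : ∀ x, 0 ≤ χ x)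
    (hχr : ∀ x, χ x ≠ 0 → x ∈ chartBall e x₀ r) (hε0 : 0 ≤ ε) (hε : ε ≤ 1 / 8)
    (ht : Continuous t) {s : ℝ} (hs : 0 < s) (hsr : s ≤ r) {x : M} (hx : x ∈ chartBall e x₀ (s / 4))
    (hmx : 0 < orbitAverage μ χ x) (ht0 : 0 ≤ t x) (htC : t x * C ≤ s / 8) :
    ∃ v ∈ Metric.closedBall (e x₀) s, averagedStep μ e χ t h x v = 0 := by
  have hxr : x ∈ chartBall e x₀ r := chartBall_mono (by linarith) hx
  have hxs : e x ∈ Metric.closedBall (e x₀) s :=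
    Metric.closedBall_subset_closedBall (by linarith) hx.2
  have hsub : Metric.closedBall (e x₀) s ⊆ Metric.closedBall (e x₀) r :=
    Metric.closedBall_subset_closedBall hsr
  set m := orbitAverage μ χ x with hm
  set T : F → F := fun v => v - m⁻¹ • averagedStep μ e χ t h x v with hT
  have hlip : ∀ v ∈ Metric.closedBall (e x₀) s, ∀ w ∈ Metric.closedBall (e x₀) s,
      ‖T v - T w‖ ≤ ε * ‖v - w‖ := by
    intro v hv w hw
    have h1 := hr.norm_averagedStep_sub_le (μ := μ) he hχ hχ0 hχr ht hxr (hsub hv) (hsub hw)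
    have h2 : T v - T w = -(m⁻¹ • (averagedStep μ e χ t h x v - averagedStep μ e χ t h x w -
        m • (v - w))) := by
      simp only [hT, smul_sub, inv_smul_smul₀ hmx.ne']
      abel
    rw [h2, norm_neg, norm_smul, norm_inv, Real.norm_eq_abs, abs_of_pos hmx, inv_mul_le_iff₀ hmx]
    exact h1
  have hself : ‖T (e x) - e x‖ ≤ s / 8 := by
    have h1 := hr.norm_averagedStep_self_le (μ := μ) hχ hχ0 hχr ht0 hxr
    rw [hT, sub_sub_cancel_left, norm_neg, norm_smul, norm_inv, Real.norm_eq_abs, abs_of_pos hmx,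
      inv_mul_le_iff₀ hmx]
    exact h1.trans (mul_le_mul_of_nonneg_left htC hmx.le)
  have hmaps : MapsTo T (Metric.closedBall (e x₀) s) (Metric.closedBall (e x₀) s) := by
    intro v hv
    have h1 := hlip v hv (e x) hxs
    have h2 : ‖v - e x‖ ≤ s + s / 4 := by
      have h3 := mem_closedBall_iff_norm.1 hv
      have h4 := mem_closedBall_iff_norm'.1 hx.2
      calc ‖v - e x‖ = ‖(v - e x₀) + (e x₀ - e x)‖ := by congr 1; abel
        _ ≤ ‖v - e x₀‖ + ‖e x₀ - e x‖ := norm_add_le _ _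
        _ ≤ s + s / 4 := add_le_add h3 h4
    rw [mem_closedBall_iff_norm]
    have h5 := mem_closedBall_iff_norm.1 hx.2
    calc ‖T v - e x₀‖ = ‖(T v - T (e x)) + (T (e x) - e x) + (e x - e x₀)‖ := by congr 1; abel
      _ ≤ ‖T v - T (e x)‖ + ‖T (e x) - e x‖ + ‖e x - e x₀‖ := norm_add₃_le
      _ ≤ ε * (s + s / 4) + s / 8 + s / 4 := by
        gcongr
        exact h1.trans (by gcongr)
      _ ≤ s := by nlinarith
  have : ProperSpace F := FiniteDimensional.proper_real F
  have hcontr : ContractingWith (Real.toNNReal ε) (hmaps.restrict T _ _) := by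
    refine ⟨by rw [Real.toNNReal_lt_one]; linarith, LipschitzWith.of_dist_le_mul ?_⟩
    rintro ⟨v, hv⟩ ⟨w, hw⟩
    rw [Real.coe_toNNReal _ hε0, Subtype.dist_eq, Subtype.dist_eq, dist_eq_norm, dist_eq_norm]
    exact hlip v hv w hw
  obtain ⟨v, hv, hfix, -⟩ := hcontr.exists_fixedPoint'
    (isCompact_closedBall (e x₀) s).isComplete hmaps hxs (edist_ne_top _ _)
  refine ⟨v, hv, ?_⟩
  have h1 : m⁻¹ • averagedStep μ e χ t h x v = 0 := by
    have : T v = v := hfix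
    rwa [hT, sub_eq_self] at this
  simpa [hmx.ne'] using h1

end AveragedStep

/-! ### Equivariant deformations near a regular point -/

section Local

variable {F : Type*} [NormedAddCommGroup F] [NormedSpace ℝ F]
  {M : Type*} [TopologicalSpace M]
  {L : Type*} [Group L] [MulAction L M]
  {e : OpenPartialHomeomorph M F} {x₀ : M} {h : F} {C ε r : ℝ}

theorem IsAveragingScale.mono (hr : IsAveragingScale L e x₀ h C ε r) {s : ℝ} (hs : s ≤ r) :
    IsAveragingScale L e x₀ h C ε s :=
  ⟨(Metric.closedBall_subset_closedBall hs).trans hr.closedBall_subset, fun g x hx y hy hgx =>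
    hr.estimates g x (chartBall_mono hs hx) y (chartBall_mono hs hy) (chartBall_mono hs hgx)⟩

variable [TopologicalSpace L] [IsTopologicalGroup L] [CompactSpace L] [T2Space L]
  [ContinuousSMul L M]

/-- The estimates hold exactly for the stabilizer of `x₀`, hence approximately, at a small scale,
for all transformations that matter at that scale. -/
theorem exists_isAveragingScale [FiniteDimensional ℝ F] [T2Space M] (he : IsC1ActionIn L e)
    (hx₀ : x₀ ∈ e.source) (h : F) {Λ : F →L[ℝ] ℝ}
    (hΛ : ∀ g : L, g • x₀ = x₀ → Λ (actDeriv e g x₀ h) = Λ h) (hneg : Λ h < 0) :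
    ∃ C ≥ 0, ∀ ε > 0, ∃ r > 0, IsAveragingScale L e x₀ h C ε r ∧
      ∀ g : L, ∀ x ∈ chartBall e x₀ r, g • x ∈ chartBall e x₀ r →
        Λ (actDeriv e g⁻¹ (g • x) h) ≤ Λ h / 2 := by
  have hinvc : ∀ g : L, g • x₀ = x₀ →
      ContinuousAt (fun p : L × M × M => actDeriv e p.1⁻¹ (p.1 • p.2.1)) (g, x₀, x₀) := by
    intro g hg
    refine ContinuousAt.comp (f := fun p : L × M × M => (p.1⁻¹, p.1 • p.2.1))
      (g := fun p : L × M => actDeriv e p.1 p.2) ?_ (by fun_prop)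
    exact he.continuousAt_actDeriv (by rwa [hg]) (by rwa [inv_smul_smul])
  obtain ⟨C₀, hC₀⟩ : ∃ C₀, ∀ g : L, g • x₀ = x₀ → ‖actDeriv e g⁻¹ (g • x₀) h‖ ≤ C₀ := by
    have hcomp : IsCompact {g : L | g • x₀ = x₀} :=
      (isClosed_eq (by fun_prop) continuous_const).isCompact
    have hcont : ContinuousOn (fun g : L => actDeriv e g⁻¹ (g • x₀) h) {g : L | g • x₀ = x₀} := by
      intro g hg
      refine ContinuousAt.continuousWithinAt ?_
      have h1 := ContinuousAt.comp (f := fun g : L => (g, x₀, x₀)) (hinvc g hg)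
        (by fun_prop : ContinuousAt (fun g : L => (g, x₀, x₀)) g)
      exact h1.clm_apply continuousAt_const
    obtain ⟨C₀, hC₀⟩ := hcomp.exists_bound_of_continuousOn hcont
    exact ⟨C₀, hC₀⟩
  refine ⟨max C₀ 0 + 1, by positivity, fun ε hε => ?_⟩
  obtain ⟨B, hB, hBP⟩ := exists_nhds_forall_smul_mem (L := L) (x₀ := x₀)
    (P := fun g x y => g • y ∈ e.source ∧
      ‖(actDeriv e g⁻¹ (g • x)).comp (actDeriv e g y) - ContinuousLinearMap.id ℝ F‖ ≤ ε ∧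
      ‖actDeriv e g⁻¹ (g • x) h‖ ≤ max C₀ 0 + 1 ∧ Λ (actDeriv e g⁻¹ (g • x) h) ≤ Λ h / 2) (by
    intro g hg
    have hg' : g⁻¹ • x₀ = x₀ := inv_smul_eq_iff.2 hg.symm
    have c1 := hinvc g hg
    have c2 : ContinuousAt (fun p : L × M × M => actDeriv e p.1 p.2.2) (g, x₀, x₀) := by
      refine ContinuousAt.comp (f := fun p : L × M × M => (p.1, p.2.2))
        (g := fun p : L × M => actDeriv e p.1 p.2) ?_ (by fun_prop)
      exact he.continuousAt_actDeriv hx₀ (by rwa [hg])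
    have c3 : ContinuousAt (fun p : L × M × M => p.1 • p.2.2) (g, x₀, x₀) := by fun_prop
    have c4 := ((c1.clm_comp c2).sub
      (continuousAt_const (y := ContinuousLinearMap.id ℝ F))).norm
    have c5 := c1.clm_apply (continuousAt_const (y := h))
    have c6 := Λ.continuous.continuousAt.comp c5
    have v4 : (actDeriv e g⁻¹ (g • x₀)).comp (actDeriv e g x₀) = ContinuousLinearMap.id ℝ F := by
      rw [← he.actDeriv_mul hx₀ (by rwa [hg]) (by rwa [inv_smul_smul]), inv_mul_cancel,
        actDeriv_one hx₀]
    refine (c3.eventually (e.open_source.mem_nhds (by simpa [hg] using hx₀))).and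
      ((c4.eventually (gt_mem_nhds ?_)).mono (fun _ h => h.le) |>.and
        (((c5.norm).eventually (gt_mem_nhds ?_)).mono (fun _ h => h.le) |>.and
          ((c6.eventually (gt_mem_nhds ?_)).mono (fun _ h => h.le))))
    · simpa [v4] using hε
    · exact (hC₀ g hg).trans_lt (by linarith [le_max_left C₀ 0])
    · have : Λ (actDeriv e g⁻¹ (g • x₀) h) = Λ h := by rw [hg]; exact hΛ _ hg'
      simp only [Function.comp_apply]
      rw [this]
      linarith)
  obtain ⟨r, hr, hrT, hrB⟩ := exists_chartBall_subset hx₀ hB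
  refine ⟨r, hr, ⟨hrT, fun g x hx y hy hgx => ?_⟩, fun g x hx hgx => ?_⟩
  · have := hBP g x (hrB hx) y (hrB hy) (hrB hgx)
    exact ⟨this.1, this.2.1, this.2.2.1⟩
  · exact (hBP g x (hrB hx) x (hrB hx) (hrB hgx)).2.2.2

variable [MeasurableSpace L] [BorelSpace L] {μ : Measure L} [IsFiniteMeasure μ] {χ t : M → ℝ}

/-- Solving the averaged equation decreases the functional, at the rate of the step size. -/
theorem IsAveragingScale.decrease [FiniteDimensional ℝ F] [T2Space M]
    (hr : IsAveragingScale L e x₀ h C ε r)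
    (he : IsC1ActionIn L e) (hχ : Continuous χ) (hχ0 : ∀ x, 0 ≤ χ x)
    (hχr : ∀ x, χ x ≠ 0 → x ∈ chartBall e x₀ r) (ht : Continuous t) (hε0 : 0 ≤ ε)
    (hε : ε ≤ 1 / 8) {Λ : F →L[ℝ] ℝ} (hεΛ : (‖Λ‖ + 1) * ε * (2 * C) ≤ -(Λ h) / 4)
    (hΛr : ∀ g : L, ∀ x ∈ chartBall e x₀ r, g • x ∈ chartBall e x₀ r →
        Λ (actDeriv e g⁻¹ (g • x) h) ≤ Λ h / 2) {f : F → ℝ}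
    (hf : ∀ u ∈ Metric.closedBall (e x₀) r, ∀ w ∈ Metric.closedBall (e x₀) r,
      ‖f u - f w - Λ (u - w)‖ ≤ ε * ‖u - w‖) {x : M} (hx : x ∈ chartBall e x₀ r)
    (hmx : 0 < orbitAverage μ χ x) (ht0 : 0 ≤ t x) {v : F} (hv : v ∈ Metric.closedBall (e x₀) r)
    (hv0 : averagedStep μ e χ t h x v = 0) :
    f v ≤ f (e x) + t x * (Λ h / 4) ∧ (t x = 0 → v = e x) := by
  set m := orbitAverage μ χ x with hm
  have h1 := hr.norm_averagedStep_sub_le (μ := μ) he hχ hχ0 hχr ht hx hv hx.2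
  have h2 := hr.norm_averagedStep_self_le (μ := μ) hχ hχ0 hχr ht0 hx
  rw [hv0, zero_sub, ← hm] at h1
  rw [← hm] at h2
  set S := averagedStep μ e χ t h x (e x) with hS
  set R := v - e x with hR
  have hRle : ‖R‖ ≤ 2 * (t x * C) := by
    have h3 : ‖m • R‖ ≤ ‖S‖ + ‖-S - m • R‖ := by
      calc ‖m • R‖ = ‖-S - (-S - m • R)‖ := by congr 1; abel
        _ ≤ ‖-S‖ + ‖-S - m • R‖ := norm_sub_le _ _
        _ = ‖S‖ + ‖-S - m • R‖ := by rw [norm_neg]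
    rw [norm_smul, Real.norm_eq_abs, abs_of_pos hmx] at h3
    have h4 : m * ‖R‖ ≤ m * (t x * C + ε * ‖R‖) := by linarith
    have h5 := le_of_mul_le_mul_left h4 hmx
    nlinarith [norm_nonneg R]
  have hΛS : m * (t x * -(Λ h / 2)) ≤ Λ S := by
    have hint := hr.integrable (μ := μ) he hχ hχr ht hx.2 hx
    have hi := integrable_smul (μ := μ) hχ x
    rw [hS, averagedStep, ← ContinuousLinearMap.integral_comp_comm _ hint, hm, orbitAverage,
      ← integral_mul_const]
    refine integral_mono (hi.mul_const _) (Λ.integrable_comp hint) fun g => ?_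
    simp only
    by_cases h0 : χ (g • x) = 0
    · simp [h0]
    rw [e.left_inv hx.1, sub_self, zero_sub, map_smul, map_neg, map_neg, map_smul, map_smul,
      smul_eq_mul, smul_eq_mul, ← mul_neg]
    have := hΛr g x hx (hχr _ h0)
    gcongr
    exact hχ0 _
  have hΛR : Λ R ≤ t x * (Λ h / 2) + ‖Λ‖ * (ε * ‖R‖) := by
    have h4 : ‖S + m • R‖ ≤ m * (ε * ‖R‖) := by
      rwa [← neg_add', norm_neg] at h1
    have h5 := Λ.le_opNorm_of_le h4
    rw [Real.norm_eq_abs] at h5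
    have h6 := (abs_le.1 h5).2
    rw [map_add, map_smul, smul_eq_mul] at h6
    have h7 : m * Λ R ≤ m * (t x * (Λ h / 2) + ‖Λ‖ * (ε * ‖R‖)) := by linarith
    exact le_of_mul_le_mul_left h7 hmx
  refine ⟨?_, fun h0 => ?_⟩
  · have h3 := (abs_le.1 (Real.norm_eq_abs _ ▸ hf v hv (e x) hx.2)).2
    have h4 : (‖Λ‖ + 1) * ε * ‖R‖ ≤ (‖Λ‖ + 1) * ε * (2 * (t x * C)) := by gcongr
    have h5 : t x * ((‖Λ‖ + 1) * ε * (2 * C)) ≤ t x * (-(Λ h) / 4) :=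
      mul_le_mul_of_nonneg_left hεΛ ht0
    linarith
  · rw [h0, zero_mul, mul_zero] at hRle
    exact sub_eq_zero.1 (norm_le_zero_iff.1 hRle)

/-- Near a point where an invariant functional has a non-zero derivative there is an equivariant
map which decreases the functional at all points that it moves, and moves the given point. -/
theorem exists_equivariant_decrease {L : Type*} [Group L] [MulAction L M] [TopologicalSpace L]
    [IsTopologicalGroup L] [CompactSpace L] [T2Space L] [ContinuousSMul L M]
    [FiniteDimensional ℝ F] [T2Space M] (he : IsC1ActionIn L e) (hx₀ : x₀ ∈ e.source)
    {φ : M → ℝ} (hφ : ContDiffAt ℝ 1 (fun z => φ (e.symm z)) (e x₀))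
    (hinv : ∀ (l : L) (x : M), φ (l • x) = φ x)
    (hne : fderiv ℝ (fun z => φ (e.symm z)) (e x₀) ≠ 0) :
    ∃ η : M → M, Continuous η ∧ (∀ (l : L) (x : M), η (l • x) = l • η x) ∧
      (∀ x, η x = x ∨ φ (η x) < φ x) ∧ φ (η x₀) < φ x₀ := by
  let _ : MeasurableSpace L := borel L
  have : BorelSpace L := ⟨rfl⟩
  -- a finite right-invariant measure on `L`
  let μ : Measure L := (Measure.haar (G := L)).inv
  set Λ := fderiv ℝ (fun z => φ (e.symm z)) (e x₀) with hΛdef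
  obtain ⟨h, hneg⟩ : ∃ h, Λ h < 0 := by
    by_contra! hcon
    refine hne (ContinuousLinearMap.ext fun v => le_antisymm ?_ (hcon v))
    have := hcon (-v)
    rw [map_neg] at this
    rw [zero_apply]
    linarith
  have hΛ : ∀ g : L, g • x₀ = x₀ → Λ (actDeriv e g x₀ h) = Λ h := by
    intro g hg
    have h1 := hasFDerivAt_comp_charts (f := φ) (g := fun y => g • y) (a := e) (D := Λ) hx₀
      (by rwa [hg]) (continuous_const_smul g).continuousAt
      (by simp only [hg]; exact hφ.hasFDerivAt_fderiv) (he.hasFDerivAt hx₀ (by rwa [hg]))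
    simp only [hinv] at h1
    have h2 := h1.fderiv
    rw [← hΛdef] at h2
    exact (DFunLike.congr_fun h2 h).symm
  obtain ⟨C, hC, hscale⟩ := exists_isAveragingScale he hx₀ h hΛ hneg
  set ε : ℝ := min (1 / 8) (-(Λ h) / 4 / ((‖Λ‖ + 1) * (2 * (C + 1)))) with hεdef
  have hε0 : 0 < ε := lt_min (by norm_num) (div_pos (by linarith) (by positivity))
  have hε8 : ε ≤ 1 / 8 := min_le_left _ _
  have hεΛ : (‖Λ‖ + 1) * ε * (2 * C) ≤ -(Λ h) / 4 := by
    have h1 : ε ≤ -(Λ h) / 4 / ((‖Λ‖ + 1) * (2 * (C + 1))) := min_le_right _ _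
    rw [le_div_iff₀ (by positivity)] at h1
    nlinarith [mul_nonneg (add_nonneg (norm_nonneg Λ) zero_le_one) hε0.le]
  obtain ⟨r₁, hr₁, hsc₁, hΛ₁⟩ := hscale ε hε0
  obtain ⟨r₂, hr₂, hf₂⟩ : ∃ r > 0, ∀ u ∈ Metric.closedBall (e x₀) r,
      ∀ w ∈ Metric.closedBall (e x₀) r,
      ‖φ (e.symm u) - φ (e.symm w) - Λ (u - w)‖ ≤ ε * ‖u - w‖ := by
    have hlit := Asymptotics.isLittleO_iff.1
      (hφ.hasStrictFDerivAt one_ne_zero).isLittleO hε0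
    rw [nhds_prod_eq] at hlit
    obtain ⟨r, hr, hrs⟩ := (Metric.nhds_basis_closedBall.prod_self.eventually_iff).1 hlit
    exact ⟨r, hr, fun u hu w hw => hrs (mk_mem_prod hu hw)⟩
  set r := min r₁ r₂ with hrdef
  have hr0 : 0 < r := lt_min hr₁ hr₂
  have hr : IsAveragingScale L e x₀ h C ε r := hsc₁.mono (min_le_left _ _)
  have hΛr : ∀ g : L, ∀ x ∈ chartBall e x₀ r, g • x ∈ chartBall e x₀ r →
      Λ (actDeriv e g⁻¹ (g • x) h) ≤ Λ h / 2 := fun g x hx hgx =>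
    hΛ₁ g x (chartBall_mono (min_le_left _ _) hx) (chartBall_mono (min_le_left _ _) hgx)
  have hb₂ : Metric.closedBall (e x₀) r ⊆ Metric.closedBall (e x₀) r₂ :=
    Metric.closedBall_subset_closedBall (min_le_right _ _)
  have hf : ∀ u ∈ Metric.closedBall (e x₀) r, ∀ w ∈ Metric.closedBall (e x₀) r,
      ‖φ (e.symm u) - φ (e.symm w) - Λ (u - w)‖ ≤ ε * ‖u - w‖ := fun u hu w hw =>
    hf₂ u (hb₂ hu) w (hb₂ hw)
  -- at the scale `s` the translates of solutions stay where solutions are unique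
  obtain ⟨s, hs0, hsr, hthin⟩ : ∃ s > 0, s ≤ r ∧ ∀ g : L, ∀ x ∈ chartBall e x₀ s,
      ∀ y ∈ chartBall e x₀ s, g • x ∈ chartBall e x₀ s → g • y ∈ chartBall e x₀ r := by
    obtain ⟨B, hB, hBP⟩ := exists_nhds_forall_smul_mem (L := L) (x₀ := x₀)
      (P := fun g _ y => g • y ∈ chartBall e x₀ r) (by
        intro g hg
        have c3 : ContinuousAt (fun p : L × M × M => p.1 • p.2.2) (g, x₀, x₀) := by fun_prop
        exact c3.eventually_mem (by simpa [hg] using chartBall_mem_nhds hx₀ hr0))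
    obtain ⟨s, hs, -, hsB⟩ := exists_chartBall_subset hx₀ hB
    have hsub := (chartBall_mono (e := e) (x₀ := x₀) (min_le_left s r)).trans hsB
    exact ⟨min s r, lt_min hs hr0, min_le_right _ _, fun g x hx y hy hgx =>
      hBP g x (hsub hx) y (hsub hy) (hsub hgx)⟩
  have hTs : Metric.closedBall (e x₀) (s / 4) ⊆ e.target :=
    (Metric.closedBall_subset_closedBall (by linarith)).trans hr.closedBall_subset
  obtain ⟨χ, hχ, hχ0, hχpos⟩ := exists_chart_bump (e := e) (x₀ := x₀) hTs
  have hχ4 : ∀ x, 0 < χ x → x ∈ chartBall e x₀ (s / 4) := fun x hx =>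
    ⟨((hχpos x).1 hx).1, ((hχpos x).1 hx).2.le⟩
  have hχr : ∀ x, χ x ≠ 0 → x ∈ chartBall e x₀ r := fun x hx =>
    chartBall_mono (by linarith) (hχ4 x (lt_of_le_of_ne (hχ0 x) hx.symm))
  have hχx₀ : 0 < χ x₀ := (hχpos x₀).2 ⟨hx₀, by rw [dist_self]; positivity⟩
  have hmpos : ∀ x, 0 < χ x → 0 < orbitAverage μ χ x := fun x hx => orbitAverage_pos hχ hχ0 hx
  set m₀ := orbitAverage μ χ x₀ with hm₀
  have hm₀pos : 0 < m₀ := hmpos x₀ hχx₀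
  set τ : ℝ := s / 8 / (C + 1) with hτ
  have hτ0 : 0 < τ := by positivity
  -- the step size: an invariant function, supported well inside the orbit of the chart ball
  set t : M → ℝ := fun x => τ * min 1 (max 0 (orbitAverage μ χ x - m₀ / 2)) with htdef
  have hmc : Continuous (orbitAverage μ χ) := continuous_orbitAverage hχ
  have htc : Continuous t := by fun_prop
  have htinv : ∀ (l : L) x, t (l • x) = t x := fun l x => by
    simp only [htdef, orbitAverage_smul]
  have ht0 : ∀ x, 0 ≤ t x := fun x => by positivity
  have htC : ∀ x, t x * C ≤ s / 8 := by
    intro x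
    have h1 : t x ≤ τ := mul_le_of_le_one_right hτ0.le (min_le_left _ _)
    have h2 : τ * (C + 1) = s / 8 := by rw [hτ]; field_simp
    nlinarith
  have hsol : ∀ x, 0 < χ x → ∃ v ∈ Metric.closedBall (e x₀) s, averagedStep μ e χ t h x v = 0 :=
    fun x hx => hr.exists_averagedStep_eq_zero he hχ hχ0 hχr hε0.le hε8 htc hs0 hsr (hχ4 x hx)
      (hmpos x hx) (ht0 x) (htC x)
  choose! V hVs hV0 using hsol
  have hVr : ∀ x, 0 < χ x → V x ∈ Metric.closedBall (e x₀) r := fun x hx =>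
    Metric.closedBall_subset_closedBall hsr (hVs x hx)
  have hxr : ∀ x, 0 < χ x → x ∈ chartBall e x₀ r := fun x hx => hχr x hx.ne'
  have hTs' : Metric.closedBall (e x₀) s ⊆ e.target :=
    (Metric.closedBall_subset_closedBall hsr).trans hr.closedBall_subset
  have hdec : ∀ x, 0 < χ x →
      φ (e.symm (V x)) ≤ φ x + t x * (Λ h / 4) ∧ (t x = 0 → e.symm (V x) = x) := by
    intro x hx
    have := hr.decrease (f := fun z => φ (e.symm z)) he hχ hχ0 hχr htc hε0.le hε8 hεΛ hΛr hf
      (hxr x hx) (hmpos x hx) (ht0 x) (hVr x hx) (hV0 x hx)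
    rw [e.left_inv (hxr x hx).1] at this
    exact ⟨this.1, fun h0 => by rw [this.2 h0, e.left_inv (hxr x hx).1]⟩
  have hequiv : ∀ (k : L) x, 0 < χ x → 0 < χ (k • x) →
      e.symm (V (k • x)) = k • e.symm (V x) := by
    intro k x hx hkx
    have hy := symm_mem_chartBall hTs' (hVs x hx)
    have hxs : x ∈ chartBall e x₀ s := chartBall_mono (by linarith) (hχ4 x hx)
    have hkxs : k • x ∈ chartBall e x₀ s := chartBall_mono (by linarith) (hχ4 _ hkx)
    have hky := hthin k x hxs _ hy hkxs
    have h1 := hr.averagedStep_smul (μ := μ) he hχ hχr htc htinv (hxr x hx) (hxr _ hkx)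
      (chartBall_mono hsr hy) hky
    rw [e.right_inv (hTs' (hVs x hx)), hV0 x hx, map_zero] at h1
    have h2 := hr.eq_of_averagedStep_eq_zero he hχ hχ0 hχr (by linarith) htc (hxr _ hkx)
      (hmpos _ hkx) (hVr _ hkx) hky.2 (hV0 _ hkx) h1
    rw [h2, e.left_inv hky.1]
  have hVcont : ∀ x, 0 < χ x → ContinuousAt V x := by
    intro x hx
    have hG : ContinuousAt (fun z => averagedStep μ e χ t h z (V x)) x := by
      refine (hr.continuousOn_averagedStep he hχ hχr htc (hVr x hx)).continuousAt ?_
      filter_upwards [(hχ.continuousAt (x := x)).eventually (lt_mem_nhds hx)] with z hz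
        using hxr z hz
    have hlim : Tendsto (fun z => 2 * (orbitAverage μ χ z)⁻¹ *
        ‖averagedStep μ e χ t h z (V x)‖) (𝓝 x) (𝓝 0) := by
      have h1 : ContinuousAt (fun z => 2 * (orbitAverage μ χ z)⁻¹ *
          ‖averagedStep μ e χ t h z (V x)‖) x :=
        (continuousAt_const.mul (hmc.continuousAt.inv₀ (hmpos x hx).ne')).mul hG.norm
      simpa [ContinuousAt, hV0 x hx] using h1
    refine tendsto_iff_norm_sub_tendsto_zero.2 (squeeze_zero' (Eventually.of_forall fun _ =>
      norm_nonneg _) ?_ hlim)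
    filter_upwards [(hχ.continuousAt (x := x)).eventually (lt_mem_nhds hx)] with z hz
    have h1 := hr.norm_averagedStep_sub_le (μ := μ) he hχ hχ0 hχr htc (hxr z hz) (hVr z hz)
      (hVr x hx)
    rw [hV0 z hz, zero_sub] at h1
    have hm := hmpos z hz
    have h2 : ‖orbitAverage μ χ z • (V z - V x)‖ ≤ ‖averagedStep μ e χ t h z (V x)‖ +
        ‖-averagedStep μ e χ t h z (V x) - orbitAverage μ χ z • (V z - V x)‖ := by
      calc _ = ‖-averagedStep μ e χ t h z (V x) - (-averagedStep μ e χ t h z (V x) -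
            orbitAverage μ χ z • (V z - V x))‖ := by congr 1; abel
        _ ≤ _ := (norm_sub_le _ _).trans (by rw [norm_neg])
    rw [norm_smul, Real.norm_eq_abs, abs_of_pos hm] at h2
    have h3 : orbitAverage μ χ z * ‖V z - V x‖ ≤ 2 * ‖averagedStep μ e χ t h z (V x)‖ := by
      nlinarith [mul_nonneg hm.le (norm_nonneg (V z - V x))]
    rw [mul_right_comm, ← div_eq_mul_inv, le_div_iff₀ hm]
    linarith
  have hmχ : ∀ x, (¬ ∃ g : L, 0 < χ (g • x)) → orbitAverage μ χ x = 0 := by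
    intro x hx
    push Not at hx
    have h1 : ∀ g : L, χ (g • x) = 0 := fun g => le_antisymm (hx g) (hχ0 _)
    simp [orbitAverage, h1]
  classical
  let η : M → M := fun x => if hx : ∃ g : L, 0 < χ (g • x) then
    hx.choose⁻¹ • e.symm (V (hx.choose • x)) else x
  have hη : ∀ (g : L) x, 0 < χ (g • x) → η x = g⁻¹ • e.symm (V (g • x)) := by
    intro g x hg
    have hx : ∃ g : L, 0 < χ (g • x) := ⟨g, hg⟩
    have h1 := hequiv (g * hx.choose⁻¹) (hx.choose • x) hx.choose_spec
      (by simpa [smul_smul] using hg)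
    simp only [smul_smul, inv_mul_cancel_right] at h1
    simp only [η, dif_pos hx, h1, smul_smul, inv_mul_cancel_left]
  have hη' : ∀ x, (¬ ∃ g : L, 0 < χ (g • x)) → η x = x := fun x hx => dif_neg hx
  have hηt : ∀ x, t x = 0 → η x = x := by
    intro x h0
    by_cases hx : ∃ g : L, 0 < χ (g • x)
    · obtain ⟨g, hg⟩ := hx
      rw [hη g x hg, (hdec _ hg).2 (by rw [htinv, h0]), inv_smul_smul]
    · exact hη' x hx
  have hηdec : ∀ x, φ (η x) ≤ φ x + t x * (Λ h / 4) := by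
    intro x
    by_cases hx : ∃ g : L, 0 < χ (g • x)
    · obtain ⟨g, hg⟩ := hx
      have := (hdec _ hg).1
      rwa [hη g x hg, hinv, ← hinv g x, ← htinv g x]
    · have h0 : t x = 0 := by
        simp only [htdef, hmχ x hx]
        rw [max_eq_left (by linarith), min_eq_right (by norm_num), mul_zero]
      rw [hη' x hx, h0, zero_mul, add_zero]
  refine ⟨η, continuous_iff_continuousAt.2 fun x => ?_, fun l x => ?_, fun x => ?_, ?_⟩
  · by_cases hx : ∃ g : L, 0 < χ (g • x)
    · obtain ⟨g, hg⟩ := hx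
      have hsm : ContinuousAt (fun z => g • z) x := (continuous_const_smul g).continuousAt
      have h1 : ContinuousAt (fun z => V (g • z)) x :=
        ContinuousAt.comp (f := fun z => g • z) (hVcont _ hg) hsm
      have h2 : ContinuousAt (fun z => e.symm (V (g • z))) x :=
        ContinuousAt.comp (f := fun z => V (g • z)) (g := e.symm)
          (e.continuousAt_symm (hTs' (hVs _ hg))) h1
      refine (h2.const_smul g⁻¹).congr ?_
      filter_upwards [(hχ.continuousAt.comp hsm).eventually (lt_mem_nhds hg)] with z hz
        using (hη g z hz).symm
    · refine continuousAt_id.congr ?_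
      have h0 : orbitAverage μ χ x < m₀ / 2 := by rw [hmχ x hx]; positivity
      filter_upwards [hmc.continuousAt.eventually (gt_mem_nhds h0)] with z hz
      refine (hηt z ?_).symm
      simp only [htdef]
      rw [max_eq_left (by linarith), min_eq_right (by norm_num), mul_zero]
  · by_cases hx : ∃ g : L, 0 < χ (g • x)
    · obtain ⟨g, hg⟩ := hx
      rw [hη g x hg, hη (g * l⁻¹) (l • x) (by simpa [smul_smul] using hg)]
      simp [smul_smul]
    · rw [hη' x hx, hη']
      rintro ⟨g, hg⟩
      exact hx ⟨g * l, by rwa [← smul_smul]⟩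
  · rcases (ht0 x).eq_or_lt with h0 | h0
    · exact Or.inl (hηt x h0.symm)
    · exact Or.inr ((hηdec x).trans_lt (by nlinarith))
  · have h0 : 0 < t x₀ :=
      mul_pos hτ0 (lt_min one_pos (lt_max_of_lt_right (by rw [← hm₀]; linarith)))
    exact (hηdec x₀).trans_lt (by nlinarith)

end Local

/-! ### The minimax argument -/

/-- Local equivariant decreasing maps compose to one which decreases the functional on a whole
compact set. -/
theorem exists_equivariant_decrease_of_isCompact {M L : Type*} [TopologicalSpace M] [Group L]
    [MulAction L M] {φ : M → ℝ} (hφ : Continuous φ) {S : Set M} (hS : IsCompact S)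
    (hloc : ∀ x₀ ∈ S, ∃ η : M → M, Continuous η ∧ (∀ (l : L) (x : M), η (l • x) = l • η x) ∧
      (∀ x, η x = x ∨ φ (η x) < φ x) ∧ φ (η x₀) < φ x₀) :
    ∃ η : M → M, Continuous η ∧ (∀ (l : L) (x : M), η (l • x) = l • η x) ∧
      (∀ x, η x = x ∨ φ (η x) < φ x) ∧ ∀ x ∈ S, φ (η x) < φ x := by
  refine hS.induction_on (p := fun S => ∃ η : M → M, Continuous η ∧
      (∀ (l : L) (x : M), η (l • x) = l • η x) ∧
      (∀ x, η x = x ∨ φ (η x) < φ x) ∧ ∀ x ∈ S, φ (η x) < φ x) ?_ ?_ ?_ ?_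
  · exact ⟨id, continuous_id, fun _ _ => rfl, fun _ => Or.inl rfl, fun _ h => h.elim⟩
  · rintro S T hST ⟨η, h1, h2, h3, h4⟩
    exact ⟨η, h1, h2, h3, fun x hx => h4 x (hST hx)⟩
  · rintro S T ⟨η, h1, h2, h3, h4⟩ ⟨θ, k1, k2, k3, k4⟩
    have hle : ∀ x, φ (η x) ≤ φ x := fun x => (h3 x).elim (fun h => by rw [h]) le_of_lt
    refine ⟨η ∘ θ, h1.comp k1, fun l x => by simp [k2, h2], fun x => ?_, fun x hx => ?_⟩
    · rcases k3 x with hx | hx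
      · simpa [hx] using h3 x
      · exact Or.inr ((hle _).trans_lt hx)
    · rcases hx with hx | hx
      · rcases k3 x with hx' | hx'
        · simpa [hx'] using h4 x hx
        · exact (hle _).trans_lt hx'
      · exact (hle _).trans_lt (k4 x hx)
  · intro x hx
    obtain ⟨η, h1, h2, h3, h4⟩ := hloc x hx
    exact ⟨{y | φ (η y) < φ y}, mem_nhdsWithin_of_mem_nhds
      ((isOpen_lt (hφ.comp h1) hφ).mem_nhds h4), η, h1, h2, h3, fun y hy => hy⟩

section Invariant

variable {L M : Type*} [Group L] [MulAction L M]

theorem IsInvariantSet.compl {A : Set M} (hA : IsInvariantSet L A) : IsInvariantSet L Aᶜ :=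
  fun l x hx hlx => hx (by simpa using hA l⁻¹ _ hlx)

theorem IsInvariantSet.inter {A B : Set M} (hA : IsInvariantSet L A) (hB : IsInvariantSet L B) :
    IsInvariantSet L (A ∩ B) := fun l x hx => ⟨hA l x hx.1, hB l x hx.2⟩

theorem IsInvariantSet.union {A B : Set M} (hA : IsInvariantSet L A) (hB : IsInvariantSet L B) :
    IsInvariantSet L (A ∪ B) := fun l x hx => hx.imp (hA l x) (hB l x)

variable [TopologicalSpace M]

theorem IsInvariantSet.closure [ContinuousConstSMul L M] {A : Set M} (hA : IsInvariantSet L A) :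
    IsInvariantSet L (closure A) := fun l _ hx =>
  map_mem_closure (continuous_const_smul l) hx fun y hy => hA l y hy

theorem LIndex.ind_le_of_subset (J : LIndex L M) {A B : Set M} (hA : IsClosed A)
    (hA' : IsInvariantSet L A) (hB : IsClosed B) (hB' : IsInvariantSet L B) (h : A ⊆ B) :
    J.ind A ≤ J.ind B :=
  J.mono A B hA hA' hB hB' id continuousOn_id h fun _ _ _ => rfl

theorem LIndex.minimax_le (J : LIndex L M) {φ : M → ℝ} {i : ℕ} {A : Set M} (hA : IsCompact A)
    (hA' : IsInvariantSet L A) (hi : (i : ℕ∞) ≤ J.ind A) {b : ℝ} (hb : ∀ x ∈ A, φ x ≤ b) :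
    J.minimax φ i ≤ b :=
  (iInf₂_le A ⟨hA, hA', hi⟩).trans (iSup₂_le fun x hx => EReal.coe_le_coe_iff.2 (hb x hx))

theorem LIndex.exists_of_minimax_lt (J : LIndex L M) {φ : M → ℝ} {i : ℕ} {b : ℝ}
    (h : J.minimax φ i < b) :
    ∃ A, IsCompact A ∧ IsInvariantSet L A ∧ (i : ℕ∞) ≤ J.ind A ∧ ∀ x ∈ A, φ x < b := by
  obtain ⟨A, hA⟩ := iInf_lt_iff.1 h
  obtain ⟨⟨h1, h2, h3⟩, hA'⟩ := iInf_lt_iff.1 hA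
  exact ⟨A, h1, h2, h3, fun x hx => EReal.coe_lt_coe_iff.1
    ((le_iSup₂ (f := fun x (_ : x ∈ A) => ((φ x : ℝ) : EReal)) x hx).trans_lt hA')⟩

/-- The abstract multiplicity estimate: if the level set `φ = c` is compact and the functional can
be decreased equivariantly near each point of it outside `K`, then the index of `K` bounds the
number of minimax values that coincide at the level `c`. -/
theorem LIndex.le_ind_of_minimax_eq [T2Space M] [ContinuousConstSMul L M] (J : LIndex L M)
    {φ : M → ℝ} (hφ : Continuous φ) (hcl : IsClosedMap φ) {n m : ℕ} (hnm : n ≤ m) {c : ℝ}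
    (hn : J.minimax φ n = (c : EReal)) (hm : J.minimax φ m = (c : EReal))
    (hZ : IsCompact {x | φ x = c}) {K : Set M} (hKcl : IsClosed K) (hKinv : IsInvariantSet L K)
    (hKZ : K ⊆ {x | φ x = c})
    (hloc : ∀ x₀, φ x₀ = c → x₀ ∉ K →
      ∃ η : M → M, Continuous η ∧ (∀ (l : L) (x : M), η (l • x) = l • η x) ∧
        (∀ x, η x = x ∨ φ (η x) < φ x) ∧ φ (η x₀) < φ x₀) :
    ((m - n + 1 : ℕ) : ℕ∞) ≤ J.ind K := by
  by_contra! hlt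
  have hKle : J.ind K ≤ ((m - n : ℕ) : ℕ∞) := by
    rw [Nat.cast_add, Nat.cast_one] at hlt
    exact Order.le_of_lt_add_one hlt
  obtain ⟨U, hU, hUinv, hKU, hUK⟩ := J.exists_nhds K (hZ.of_isClosed_subset hKcl hKZ) hKcl hKinv
  have hS : IsCompact ({x | φ x = c} ∩ Uᶜ) := hZ.inter_right hU.isClosed_compl
  obtain ⟨η, hη, hηL, hηφ, hηS⟩ := exists_equivariant_decrease_of_isCompact (L := L) hφ hS
    fun x hx => hloc x hx.1 fun hxK => hx.2 (hKU hxK)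
  have hηle : ∀ x, φ (η x) ≤ φ x := fun x => (hηφ x).elim (fun h => by rw [h]) le_of_lt
  obtain ⟨δ, hδ, hSδ⟩ : ∃ δ > 0, ∀ x ∈ {x | φ x = c} ∩ Uᶜ, φ (η x) < c - δ := by
    rcases ({x | φ x = c} ∩ Uᶜ).eq_empty_or_nonempty with h | h
    · exact ⟨1, one_pos, fun x hx => by simp [h] at hx⟩
    · obtain ⟨y, hy, hmax⟩ := hS.exists_isMaxOn h (hφ.comp hη).continuousOn
      have hyc : φ (η y) < c := (hηS y hy).trans_eq hy.1
      refine ⟨(c - φ (η y)) / 2, by linarith, fun x hx => ?_⟩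
      have : φ (η x) ≤ φ (η y) := hmax hx
      linarith
  -- the closed functional has a tube of levels around the level set
  obtain ⟨ε, hε, hεO⟩ : ∃ ε > 0, ∀ x, |φ x - c| < ε → x ∈ U ∪ {x | φ (η x) < c - δ} := by
    have hO : IsOpen (U ∪ {x | φ (η x) < c - δ}) :=
      hU.union (isOpen_lt (hφ.comp hη) continuous_const)
    have hc : c ∈ (φ '' (U ∪ {x | φ (η x) < c - δ})ᶜ)ᶜ := by
      rintro ⟨x, hx, hxc⟩
      exact hx ((em (x ∈ U)).imp id fun hxU => hSδ x ⟨hxc, hxU⟩)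
    obtain ⟨ε, hε, hball⟩ := Metric.isOpen_iff.1 (hcl _ hO.isClosed_compl).isOpen_compl c hc
    refine ⟨ε, hε, fun x hx => ?_⟩
    by_contra hxO
    exact hball (show φ x ∈ Metric.ball c ε from hx) ⟨x, hxO, rfl⟩
  set ε' := min ε δ with hε'
  have hε'0 : 0 < ε' := lt_min hε hδ
  obtain ⟨A, hA, hAinv, hAm, hAφ⟩ := J.exists_of_minimax_lt (φ := φ) (i := m) (b := c + ε')
    (by rw [hm]; exact EReal.coe_lt_coe_iff.2 (by linarith))
  have hA' : IsCompact (A ∩ Uᶜ) := hA.inter_right hU.isClosed_compl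
  have hA'inv : IsInvariantSet L (A ∩ Uᶜ) := hAinv.inter hUinv.compl
  have hB : IsCompact (η '' (A ∩ Uᶜ)) := hA'.image hη
  have hBinv : IsInvariantSet L (η '' (A ∩ Uᶜ)) := by
    rintro l _ ⟨x, hx, rfl⟩
    exact ⟨l • x, hA'inv l x hx, hηL l x⟩
  have hA'n : (n : ℕ∞) ≤ J.ind (A ∩ Uᶜ) := by
    have h1 : J.ind A ≤ J.ind (A ∩ Uᶜ) + J.ind (closure U) := by
      refine le_trans ?_ (J.union_le _ _ hA'.isClosed hA'inv isClosed_closure hUinv.closure)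
      refine J.ind_le_of_subset hA.isClosed hAinv (hA'.isClosed.union isClosed_closure)
        (hA'inv.union hUinv.closure) fun x hx => ?_
      by_cases hxU : x ∈ U
      · exact Or.inr (subset_closure hxU)
      · exact Or.inl ⟨hx, hxU⟩
    have h2 : (m : ℕ∞) ≤ J.ind (A ∩ Uᶜ) + ((m - n : ℕ) : ℕ∞) :=
      hAm.trans (h1.trans (by rw [hUK]; gcongr))
    rcases eq_or_ne (J.ind (A ∩ Uᶜ)) ⊤ with h | h
    · simp [h]
    · lift J.ind (A ∩ Uᶜ) to ℕ using h with i
      norm_cast at h2 ⊢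
      omega
  have hBn : (n : ℕ∞) ≤ J.ind (η '' (A ∩ Uᶜ)) :=
    hA'n.trans (J.mono _ _ hA'.isClosed hA'inv hB.isClosed hBinv η hη.continuousOn
      (mapsTo_image _ _) fun l x _ => hηL l x)
  have hBφ : ∀ y ∈ η '' (A ∩ Uᶜ), φ y ≤ c - ε' := by
    rintro _ ⟨x, ⟨hxA, hxU⟩, rfl⟩
    rcases le_or_gt (φ x) (c - ε') with h | h
    · exact (hηle x).trans h
    · have h1 : |φ x - c| < ε := by
        have := hAφ x hxA
        have h2 : ε' ≤ ε := min_le_left _ _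
        rw [abs_lt]
        constructor <;> linarith
      have h2 : φ (η x) < c - δ := (hεO x h1).resolve_left hxU
      have h3 : ε' ≤ δ := min_le_right _ _
      linarith
  have hfin := J.minimax_le hB hBinv hBn hBφ
  rw [hn, EReal.coe_le_coe_iff] at hfin
  linarith

end Invariant

/-- The multiplicity theorem over a finite-dimensional normed model space. -/
theorem le_ind_criticalSet {F : Type*} [NormedAddCommGroup F] [NormedSpace ℝ F]
    [FiniteDimensional ℝ F] {M : Type*} [TopologicalSpace M] [T3Space M] [ChartedSpace F M]
    (hM : IsKellerManifold F M) (N : FinslerStructure F M) (hgraded : N.IsGraded)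
    {L : Type*} [Group L] [TopologicalSpace L] [IsTopologicalGroup L] [T2Space L] [CompactSpace L]
    [MulAction L M] [ContinuousSMul L M] (hact : ∀ l : L, IsKellerC1SelfMap F (fun x : M => l • x))
    {φ : M → ℝ} (hφ : IsKellerC1Functional F φ) (hcl : IsClosedMap φ)
    (hinv : ∀ (l : L) (x : M), φ (l • x) = φ x)
    (J : LIndex L M) {n m : ℕ} (hnm : n ≤ m) {c : ℝ}
    (hn : J.minimax φ n = (c : EReal)) (hm : J.minimax φ m = (c : EReal))
    (hPS : N.PalaisSmale φ c) :
    IsClosed (criticalSet F φ c) ∧ IsInvariantSet L (criticalSet F φ c) ∧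
      ((m - n + 1 : ℕ) : ℕ∞) ≤ J.ind (criticalSet F φ c) ∧ (criticalSet F φ c).Nonempty := by
  have hKcl := isClosed_criticalSet hM hφ c
  have hKinv := isInvariantSet_criticalSet (L := L) hM hφ hact hinv c
  have hind : ((m - n + 1 : ℕ) : ℕ∞) ≤ J.ind (criticalSet F φ c) := by
    refine J.le_ind_of_minimax_eq hφ.1 hcl hnm hn hm (N.isCompact_level hM hgraded hφ hcl hPS)
      hKcl hKinv (fun x hx => hx.2) fun x₀ hx₀c hx₀ => ?_
    have ha := chart_mem_atlas F x₀
    have hxs := mem_chart_source F x₀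
    have he : IsC1ActionIn L (chartAt F x₀) := fun l x hx hlx =>
      (hact l).contDiffAt ha ha hx hlx
    refine exists_equivariant_decrease he hxs (hφ.contDiffAt ha hxs) hinv fun h0 => hx₀ ⟨?_, hx₀c⟩
    exact (differential_eq_zero_iff hM hφ ha hxs).2 h0
  refine ⟨hKcl, hKinv, hind, nonempty_iff_ne_empty.2 fun h => ?_⟩
  rw [(J.eq_zero_iff _ hKcl hKinv).2 h] at hind
  norm_cast at hind

end FrechetLS

theorem mainTheorem2
    -- the Fréchet space `F`
    {F : Type*} [AddCommGroup F] [Module ℝ F] [UniformSpace F] [IsUniformAddGroup F]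
    [ContinuousSMul ℝ F] [LocallyConvexSpace ℝ F] [CompleteSpace F] [T2Space F]
    [FirstCountableTopology F]
    -- the connected regular `C_c^1` manifold `M` with its complete graded Finsler structure
    {M : Type*} [TopologicalSpace M] [T3Space M] [ConnectedSpace M] [ChartedSpace F M]
    (hM : FrechetLS.IsKellerManifold F M)
    (N : FrechetLS.FinslerStructure F M) (hgraded : N.IsGraded) (hcomplete : N.IsComplete)
    -- the compact Lie group `L`
    {V : Type*} [NormedAddCommGroup V] [NormedSpace ℝ V] [FiniteDimensional ℝ V]
    {L : Type*} [Group L] [TopologicalSpace L] [T2Space L] [ChartedSpace V L]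
    [LieGroup 𝓘(ℝ, V) ∞ L] [CompactSpace L]
    -- its action, continuous and by `C_c^1` transformations
    [MulAction L M] [ContinuousSMul L M]
    (hact : ∀ l : L, FrechetLS.IsKellerC1SelfMap F (fun x : M => l • x))
    -- the functional
    (φ : M → ℝ) (hφ : FrechetLS.IsKellerC1Functional F φ)
    (hnonconst : ∃ x y, φ x ≠ φ y) (hclosed : IsClosedMap φ)
    (hinv : ∀ (l : L) (x : M), φ (l • x) = φ x)
    -- the index and the minimax level
    (J : FrechetLS.LIndex L M) (n m : ℕ) (hnm : n ≤ m) (c : ℝ)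
    (hn : J.minimax φ n = (c : EReal)) (hm : J.minimax φ m = (c : EReal))
    (hPS : N.PalaisSmale φ c) :
    IsClosed (FrechetLS.criticalSet F φ c) ∧
    FrechetLS.IsInvariantSet L (FrechetLS.criticalSet F φ c) ∧
    ((m - n + 1 : ℕ) : ℕ∞) ≤ J.ind (FrechetLS.criticalSet F φ c) ∧
    (FrechetLS.criticalSet F φ c).Nonempty := by
  have : FiniteDimensional ℝ F := FrechetLS.finiteDimensional_of_isClosedMap hφ hnonconst hclosed
  have : IsTopologicalGroup L := topologicalGroup_of_lieGroup 𝓘(ℝ, V) ∞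
  let _ : NormedAddCommGroup F := FrechetLS.finiteDimensionalNorm F
  let _ : NormedSpace ℝ F :=
    { norm_smul_le := fun a v => FrechetLS.norm_smul_finiteDimensionalNorm F a v }
  exact FrechetLS.le_ind_criticalSet hM N hgraded hact hφ hclosed hinv J hnm hn hm hPS
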